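/- Let $n\ge 1$. For a convex body $K\subset\mathbb{R}^{n+1}$ let $h_K(x)=\max_{y\in K}\langle x,y\rangle$ be its support function. Let $\mathcal K_e$ be the set of origin-symmetric convex bodies with nonempty interior in $\mathbb{R}^{n+1}$, and let $\mathcal K^2_{+,e}\subset\mathcal K_e$ be the set of those for which $h=h_K$ is $C^2$ on $S^n$ and $H=\nabla^2h+h\,\mathrm{Id}$ is positive definite at every point of $S^n$. Write $(H^{ij})$ for the inverse of $H$, $dS$ for the area measure of $S^n$, and $C^2_e(S^n)$ for the even $C^2$ functions on $S^n$. For $K\in\mathcal K^2_{+,e}$ and $u\in C_e^2(S^n)$ define the measures on $S^n$ $$\mathfrak m_{K,u}=H^{ij}u_iu_j\det H\,dS,\qquad \tau_K=H^{ij}\delta_{ij}\det H\,dS,\qquad S_K=\det H\,dS .$$ For any other $K\in\mathcal K_e$ let $\mathfrak m_{K,u},\tau_K,S_K$ be the weak limits (against continuous functions on $S^n$) of $\mathfrak m_{K',u},\tau_{K'},S_{K'}$ as $K'\in\mathcal K^2_{+,e}$ tends to $K$ in the Hausdorff metric. For $K\in\mathcal K_e$, with $h=h_K$ and $\underline u=\left(\int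 h\,dS_K\right)^{-1}\int u\,h\,dS_K$, put $$\lambda_{1,e}(-L_K)=\inf_{u}\frac{\int_{S^n}h^2\,d\mathfrak m_{K,u}}{\int_{S^n}(u-\underline u)^2\,h\,dS_K},$$ $$\lambda_{1,e}(K)=\inf_{z}\frac{\int_{S^n}d\mathfrak m_{K,z}-\int_{S^n}z^2\,d\tau_K+n\int_{S^n}z^2h^{-1}\,dS_K}{\int_{S^n}z^2h^{-1}\,dS_K-\left(\int_{S^n}h\,dS_K\right)^{-1}\left(\int_{S^n}z\,dS_K\right)^2},$$ where $u$ and $z$ run over the functions in $C^2_e(S^n)$ for which the denominator is nonzero, and the infima are taken in $[-\infty,\infty]$. **Proposition.** Let $K\in\mathcal K_e$, and let $K_k\in\mathcal K^2_{+,e}$ ($k\in\mathbb N$) converge to $K$ in the Hausdorff metric. Then $\mathfrak m_{K_k,u}\to\mathfrak m_{K,u}$ for every $u\in C^2_e(S^n)$, $\tau_{K_k}\to\tau_K$ and $S_{K_k}\to S_K$ weakly (so that the definitions above make sense), and $$\lambda_{1,e}(-L_K)\ \ge\ \limsup_{k\to\infty}\lambda_{1,e}(-L_{K_k}),\qquad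 \lambda_{1,e}(K)\ \ge\ \limsup_{k\to\infty}\lambda_{1,e}(K_k).$$ -/

import Mathlib

open Set Filter Topology MeasureTheory Metric
open scoped Manifold ContDiff Matrix

noncomputable section

namespace EvenEigenvalue

/-- The ambient Euclidean space `ℝ^{n+1}`. -/
abbrev E (n : ℕ) : Type := EuclideanSpace ℝ (Fin (n + 1))

/-- The unit sphere `S^n` of `ℝ^{n+1}`. -/
abbrev S (n : ℕ) : Type := sphere (0 : E n) 1

/-- The area measure `dS` of the unit sphere `S^n`. -/
def area (n : ℕ) : Measure (S n) := (volume : Measure (E n)).toSphere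

/-- The support function `h_K(x) = max_{y ∈ K} ⟨x, y⟩` of a convex body, on all of `ℝ^{n+1}`. -/
def supp {n : ℕ} (K : ConvexBody (E n)) (x : E n) : ℝ :=
  sSup ((fun y : E n => inner ℝ x y) '' (K : Set (E n)))

/-- The second derivative `D²h_K(x)(v, w)` of the (1-homogeneous) support function. For a unit
vector `x` and `v, w ⟂ x` it is equal to `(∇²h_K + h_K Id)(v, w)` at the point `x` of `S^n`. -/
def hess {n : ℕ} (K : ConvexBody (E n)) (x v w : E n) : ℝ :=
  fderiv ℝ (fderiv ℝ (supp K)) x v w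

/-- The class `𝒦_e`: convex bodies with nonempty interior that are symmetric about the origin. -/
def IsEvenBody {n : ℕ} (K : ConvexBody (E n)) : Prop :=
  (interior (K : Set (E n))).Nonempty ∧ ∀ x ∈ K, -x ∈ K

/-- The class `𝒦²_{+,e}`: bodies in `𝒦_e` whose support function is `C²` (away from the origin, or,
what is the same by homogeneity, on `S^n`) with `∇²h_K + h_K Id > 0` at each point of `S^n`. -/
def IsEvenC2Plus {n : ℕ} (K : ConvexBody (E n)) : Prop :=
  IsEvenBody K ∧ ContDiffOn ℝ 2 (supp K) {0}ᶜ ∧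
    ∀ x v : E n, ‖x‖ = 1 → inner ℝ x v = 0 → v ≠ 0 → 0 < hess K x v v

/-- The class `C²_e(S^n)` of even `C²` functions on the sphere. -/
def IsEvenC2 {n : ℕ} (u : S n → ℝ) : Prop :=
  ContMDiff (𝓡 n) 𝓘(ℝ, ℝ) 2 u ∧ ∀ x : S n, u (-x) = u x

open Classical in
/-- The extension of a function on `S^n` to a 0-homogeneous function on `ℝ^{n+1} \ {0}`. -/
def ext0 {n : ℕ} (u : S n → ℝ) (y : E n) : ℝ :=
  if hy : y = 0 then 0
  else u ⟨‖y‖⁻¹ • y, by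
    simp [norm_smul, inv_mul_cancel₀ (norm_ne_zero_iff.2 hy)]⟩

/-- The gradient `∇u(x)` of a function on the sphere, a vector orthogonal to `x`. -/
def sphereGrad {n : ℕ} (u : S n → ℝ) (x : S n) : E n := gradient (ext0 u) (x : E n)

/-- The matrix `A = D²h_K + dr ⊗ dr` at `x ∈ S^n` in the standard basis of `ℝ^{n+1}`. In an
orthonormal basis adapted to `ℝ^{n+1} = x^⊥ ⊕ ℝ x` it is block diagonal, with the blocks
`H = ∇²h_K + h_K Id` and `1`; so its adjugate is block diagonal with the blocks `U`, the cofactor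
matrix of `H`, and `det H`. -/
def bodyMatrix {n : ℕ} (K : ConvexBody (E n)) (x : S n) :
    Matrix (Fin (n + 1)) (Fin (n + 1)) ℝ :=
  Matrix.of fun i j =>
    hess K x (EuclideanSpace.single i 1) (EuclideanSpace.single j 1) + (x : E n) i * (x : E n) j

/-- `det H = det (∇²h_K + h_K Id)` at a point of the sphere. -/
def detH {n : ℕ} (K : ConvexBody (E n)) (x : S n) : ℝ := (bodyMatrix K x).det

/-- The value `⟨U v, v⟩` on a vector `v` of `ℝ^{n+1}`; for `v ⟂ x` this is `U^{ij} v_i v_j`, which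
is `H^{ij} v_i v_j det H` when `H` is invertible. -/
def cofactorForm {n : ℕ} (K : ConvexBody (E n)) (x : S n) (v : E n) : ℝ :=
  ∑ i, ∑ j, (bodyMatrix K x).adjugate i j * v i * v j

/-- The density `U^{ij} u_i u_j = H^{ij} u_i u_j det H`. -/
def gradDensity {n : ℕ} (u : S n → ℝ) (K : ConvexBody (E n)) (x : S n) : ℝ :=
  cofactorForm K x (sphereGrad u x)

/-- The density `U^{ij} δ_{ij} = H^{ij} δ_{ij} det H`, the trace of the cofactor matrix of `H`: from
the trace on `ℝ^{n+1}` one removes the entry in the direction of `x`. -/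
def traceDensity {n : ℕ} (K : ConvexBody (E n)) (x : S n) : ℝ :=
  (bodyMatrix K x).adjugate.trace - cofactorForm K x (x : E n)

/-- Weak convergence of measures on `S^n`, tested against continuous functions. -/
def WeakConv {n : ℕ} {ι : Type*} (ν : ι → Measure (S n)) (l : Filter ι) (μ : Measure (S n)) :
    Prop :=
  ∀ φ : C(S n, ℝ), Tendsto (fun k => ∫ x, φ x ∂(ν k)) l (𝓝 (∫ x, φ x ∂μ))

open Classical in
/-- The measure on `S^n` attached to a convex body `K` by a nonnegative density `ρ_{K'}` that makes
sense for `K' ∈ 𝒦²_{+,e}`: it is `ρ_K dS` if `K ∈ 𝒦²_{+,e}`, and in general the weak limit of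
`ρ_{K'} dS` as `K' ∈ 𝒦²_{+,e}` tends to `K` in the Hausdorff metric
(and, by convention, `0` if there is no such limit). -/
def bodyMeasure {n : ℕ} (ρ : ConvexBody (E n) → S n → ℝ) (K : ConvexBody (E n)) :
    Measure (S n) :=
  if IsEvenC2Plus K then (area n).withDensity fun x => ENNReal.ofReal (ρ K x)
  else if h : ∃ μ : Measure (S n), IsFiniteMeasure μ ∧
      WeakConv (fun K' => (area n).withDensity fun x => ENNReal.ofReal (ρ K' x))
        (𝓝[{K' | IsEvenC2Plus K'}] K) μ then h.choose
  else 0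

/-- The measure `𝔪_{K,u} = U^{ij} u_i u_j dS`. -/
def gradMeasure {n : ℕ} (K : ConvexBody (E n)) (u : S n → ℝ) : Measure (S n) :=
  bodyMeasure (gradDensity u) K

/-- The measure `U^{ij} δ_{ij} dS`. -/
def traceMeasure {n : ℕ} (K : ConvexBody (E n)) : Measure (S n) :=
  bodyMeasure traceDensity K

/-- The surface area measure `dS_K = det H dS`. -/
def surfMeasure {n : ℕ} (K : ConvexBody (E n)) : Measure (S n) :=
  bodyMeasure detH K

/-- The mean `u̲` of `u` with respect to `h_K dS_K`. -/
def mean {n : ℕ} (K : ConvexBody (E n)) (u : S n → ℝ) : ℝ :=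
  (∫ x, supp K x ∂(surfMeasure K))⁻¹ * ∫ x, u x * supp K x ∂(surfMeasure K)

/-- `∫ H^{ij} h² u_i u_j det H dS`. -/
def energy {n : ℕ} (K : ConvexBody (E n)) (u : S n → ℝ) : ℝ :=
  ∫ x, supp K x ^ 2 ∂(gradMeasure K u)

/-- `∫ (u - u̲)² h det H dS`. -/
def spread {n : ℕ} (K : ConvexBody (E n)) (u : S n → ℝ) : ℝ :=
  ∫ x, (u x - mean K u) ^ 2 * supp K x ∂(surfMeasure K)

/-- The first even eigenvalue `λ_{1,e}(-L_K)`, the infimum of the Rayleigh quotients of the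
`u ∈ C²_e(S^n)` that are not constant in `L²(h_K dS_K)`. -/
def eigenL {n : ℕ} (K : ConvexBody (E n)) : EReal :=
  ⨅ (u : S n → ℝ) (_ : IsEvenC2 u) (_ : spread K u ≠ 0),
    ((energy K u / spread K u : ℝ) : EReal)

/-- `∫ H^{ij} z_i z_j det H dS - ∫ H^{ij} δ_{ij} z² det H dS + n ∫ z² h⁻¹ det H dS`. -/
def energy' {n : ℕ} (K : ConvexBody (E n)) (z : S n → ℝ) : ℝ :=
  (∫ _x, (1 : ℝ) ∂(gradMeasure K z)) - (∫ x, z x ^ 2 ∂(traceMeasure K))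
    + n * ∫ x, z x ^ 2 * (supp K x)⁻¹ ∂(surfMeasure K)

/-- `∫ z² h⁻¹ det H dS - (∫ h det H dS)⁻¹ (∫ z det H dS)²`. -/
def spread' {n : ℕ} (K : ConvexBody (E n)) (z : S n → ℝ) : ℝ :=
  (∫ x, z x ^ 2 * (supp K x)⁻¹ ∂(surfMeasure K))
    - (∫ x, supp K x ∂(surfMeasure K))⁻¹ * (∫ x, z x ∂(surfMeasure K)) ^ 2

/-- The second form `λ_{1,e}(K)` of the first even eigenvalue. -/
def eigenK {n : ℕ} (K : ConvexBody (E n)) : EReal :=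
  ⨅ (z : S n → ℝ) (_ : IsEvenC2 z) (_ : spread' K z ≠ 0),
    ((energy' K z / spread' K z : ℝ) : EReal)

end EvenEigenvalue

end

/-! For a fixed test function each Rayleigh quotient is built from integrals against the three
measures. Weak convergence of the measures, uniform convergence of the support functions and `∫ h
dS_K > 0` therefore make numerators and denominators converge. A competitor for `K` with nonzero
denominator is a competitor for `K_k` once `k` is large, which gives the semicontinuity of the
infima (`limsup_iInf_quotient_le`).

Weak convergence is reduced to the Hausdorff continuity of the volume (`continuousAt_vol`). For
smooth `K`, `L` a change of variables on `(K + tL) \ K` shows that `vol (K + tL) - vol K` is the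
integral of `h_L det(H_K + s H_L)` over `S^n × [0, t]` (`vol_add_smul`). This is a polynomial in
`t`, so its linear coefficient `∫ h_L det H_K dS` is a fixed linear combination of volumes of bodies
`K + jL`. Replacing `K` by `K + jM` and extracting a linear coefficient once more does the same for
`∫ h_L U^{ij} (h_M)_{ij} dS`, where `f_{ij}` stands for `∇²f + f Id`. The resulting combinations of
volumes make sense, and are continuous, without smoothness of `K`.

Every `C²` function on the sphere is a support function minus a constant (`exists_body`), so `h_L`
and `h_M` may be replaced by arbitrary `C²` functions. The trace density is the case where `h_M` is
replaced by `1`, and the gradient density follows from `u_i u_j = ½ (u²)_{ij} - u u_{ij} + ½ u²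
δ_{ij}` (`gradDensity_eq`). Finally, nonnegative densities whose integrals against `C²` functions
converge have a weak limit, by density and the Riesz–Markov theorem (`exists_weakConv`). -/

noncomputable section

namespace EvenEigenvalue

/-! ### Second derivatives of 1-homogeneous functions -/

variable {n : ℕ}

/-- Positively `1`-homogeneous functions that are `C²` away from the origin. -/
structure Hom2 (f : E n → ℝ) : Prop where
  contDiffOn : ContDiffOn ℝ 2 f {0}ᶜ
  hom : ∀ c : ℝ, 0 < c → ∀ x, f (c • x) = c * f x

lemma isOpen_compl_zero : IsOpen ({0}ᶜ : Set (E n)) := isOpen_compl_singleton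

lemma contDiffAt_of_compl_zero {f : E n → ℝ} (hf : ContDiffOn ℝ 2 f {0}ᶜ) {x : E n} (hx : x ≠ 0) :
    ContDiffAt ℝ 2 f x :=
  hf.contDiffAt (isOpen_compl_zero.mem_nhds hx)

lemma contDiffOn_compl_zero {f : E n → ℝ} (hf : ∀ x : E n, x ≠ 0 → ContDiffAt ℝ 2 f x) :
    ContDiffOn ℝ 2 f {0}ᶜ :=
  fun x hx => (hf x hx).contDiffWithinAt

lemma contDiffAt_fderiv {f : E n → ℝ} {x : E n} (hf : ContDiffAt ℝ 2 f x) :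
    ContDiffAt ℝ 1 (fderiv ℝ f) x :=
  hf.fderiv_right (m := 1) (by norm_num)

lemma differentiableAt_fderiv {f : E n → ℝ} {x : E n} (hf : ContDiffAt ℝ 2 f x) :
    DifferentiableAt ℝ (fderiv ℝ f) x :=
  (contDiffAt_fderiv hf).differentiableAt (by norm_num)

lemma continuousAt_fderiv_fderiv {f : E n → ℝ} {x : E n} (hf : ContDiffAt ℝ 2 f x) :
    ContinuousAt (fderiv ℝ (fderiv ℝ f)) x :=
  ((contDiffAt_fderiv hf).fderiv_right (m := 0) (by norm_num)).continuousAt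

lemma fderiv_fderiv_symm {f : E n → ℝ} {x : E n} (hf : ContDiffAt ℝ 2 f x) (v w : E n) :
    fderiv ℝ (fderiv ℝ f) x v w = fderiv ℝ (fderiv ℝ f) x w v :=
  (hf.isSymmSndFDerivAt (by simp)).eq v w

lemma fderiv_fderiv_add {f g : E n → ℝ} {x : E n} (hf : ContDiffAt ℝ 2 f x)
    (hg : ContDiffAt ℝ 2 g x) :
    fderiv ℝ (fderiv ℝ (fun y => f y + g y)) x
      = fderiv ℝ (fderiv ℝ f) x + fderiv ℝ (fderiv ℝ g) x := by
  have : fderiv ℝ (fun y => f y + g y) =ᶠ[𝓝 x] fun y => fderiv ℝ f y + fderiv ℝ g y := by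
    filter_upwards [hf.eventually (by simp), hg.eventually (by simp)] with y h1 h2
    exact fderiv_fun_add (h1.differentiableAt (by norm_num)) (h2.differentiableAt (by norm_num))
  rw [this.fderiv_eq, fderiv_fun_add (differentiableAt_fderiv hf) (differentiableAt_fderiv hg)]

lemma fderiv_fderiv_const_mul {f : E n → ℝ} {x : E n} (c : ℝ) (hf : ContDiffAt ℝ 2 f x) :
    fderiv ℝ (fderiv ℝ (fun y => c * f y)) x = c • fderiv ℝ (fderiv ℝ f) x := by
  have : fderiv ℝ (fun y => c * f y) =ᶠ[𝓝 x] fun y => c • fderiv ℝ f y := by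
    filter_upwards [hf.eventually (by simp)] with y h1
    exact fderiv_const_mul (h1.differentiableAt (by norm_num)) c
  rw [this.fderiv_eq, fderiv_fun_const_smul (differentiableAt_fderiv hf)]

lemma fderiv_fderiv_mul {f g : E n → ℝ} {x : E n} (hf : ContDiffAt ℝ 2 f x)
    (hg : ContDiffAt ℝ 2 g x) (v w : E n) :
    fderiv ℝ (fderiv ℝ (fun y => f y * g y)) x v w
      = f x * fderiv ℝ (fderiv ℝ g) x v w + fderiv ℝ f x v * fderiv ℝ g x w
        + g x * fderiv ℝ (fderiv ℝ f) x v w + fderiv ℝ g x v * fderiv ℝ f x w := by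
  have : fderiv ℝ (fun y => f y * g y) =ᶠ[𝓝 x]
      fun y => f y • fderiv ℝ g y + g y • fderiv ℝ f y := by
    filter_upwards [hf.eventually (by simp), hg.eventually (by simp)] with y h1 h2
    exact fderiv_fun_mul (h1.differentiableAt (by norm_num)) (h2.differentiableAt (by norm_num))
  have h1 := (hf.differentiableAt (by norm_num)).hasFDerivAt
  have h2 := (hg.differentiableAt (by norm_num)).hasFDerivAt
  have h3 := (differentiableAt_fderiv hf).hasFDerivAt
  have h4 := (differentiableAt_fderiv hg).hasFDerivAt
  have h5 : HasFDerivAt (fun y => f y • fderiv ℝ g y + g y • fderiv ℝ f y) _ x :=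
    (h1.smul h4).add (h2.smul h3)
  rw [this.fderiv_eq, h5.fderiv]
  simp
  ring

namespace Hom2

variable {f g : E n → ℝ}

lemma contDiffAt (hf : Hom2 f) {x : E n} (hx : x ≠ 0) : ContDiffAt ℝ 2 f x :=
  contDiffAt_of_compl_zero hf.contDiffOn hx

lemma differentiableAt (hf : Hom2 f) {x : E n} (hx : x ≠ 0) : DifferentiableAt ℝ f x :=
  (hf.contDiffAt hx).differentiableAt (by norm_num)

lemma add (hf : Hom2 f) (hg : Hom2 g) : Hom2 (fun y => f y + g y) :=
  ⟨hf.contDiffOn.add hg.contDiffOn, fun c hc x => by rw [hf.hom c hc, hg.hom c hc]; ring⟩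

lemma const_mul (a : ℝ) (hf : Hom2 f) : Hom2 (fun y => a * f y) :=
  ⟨contDiffOn_const.mul hf.contDiffOn, fun c hc x => by rw [hf.hom c hc]; ring⟩

lemma map_zero (hf : Hom2 f) : f 0 = 0 := by
  have := hf.hom 2 (by norm_num) 0
  rw [smul_zero] at this
  linarith

/-- Euler's identity: differentiate `f (c x) = c f x` in `c` at `c = 1`. -/
lemma fderiv_self (hf : Hom2 f) {x : E n} (hx : x ≠ 0) : fderiv ℝ f x x = f x := by
  have h1 : HasDerivAt (fun c : ℝ => c • x) x 1 := by
    simpa using (hasDerivAt_id (1 : ℝ)).smul_const x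
  have h2 : HasFDerivAt f (fderiv ℝ f x) ((1 : ℝ) • x) := by
    rw [one_smul]; exact (hf.differentiableAt hx).hasFDerivAt
  have h3 := h2.comp_hasDerivAt (1 : ℝ) h1
  have h4 : HasDerivAt (fun c : ℝ => c * f x) (f x) 1 := by
    simpa using (hasDerivAt_id (1 : ℝ)).mul_const (f x)
  refine h3.unique (h4.congr_of_eventuallyEq ?_)
  filter_upwards [lt_mem_nhds (zero_lt_one (α := ℝ))] with c hc
  exact hf.hom c hc x

lemma fderiv_smul (hf : Hom2 f) {c : ℝ} (hc : 0 < c) (x : E n) :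
    fderiv ℝ f (c • x) = fderiv ℝ f x := by
  rcases eq_or_ne x 0 with rfl | hx
  · simp
  have h1 : HasFDerivAt (fun y => f (c • y)) ((fderiv ℝ f (c • x)).comp
      (c • ContinuousLinearMap.id ℝ (E n))) x :=
    ((hf.differentiableAt (smul_ne_zero hc.ne' hx)).hasFDerivAt).comp x
      ((hasFDerivAt_id x).const_smul c)
  have h2 : (fun y => f (c • y)) = fun y => c * f y := by
    ext y; exact hf.hom c hc y
  rw [h2] at h1
  have h3 := h1.unique ((hf.differentiableAt hx).hasFDerivAt.const_mul c)
  ext v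
  have := DFunLike.congr_fun h3 v
  simp at this
  exact this.resolve_right hc.ne'

lemma fderiv_fderiv_smul (hf : Hom2 f) {c : ℝ} (hc : 0 < c) {x : E n} (hx : x ≠ 0) :
    fderiv ℝ (fderiv ℝ f) (c • x) = c⁻¹ • fderiv ℝ (fderiv ℝ f) x := by
  have h1 : HasFDerivAt (fun y => fderiv ℝ f (c • y)) ((fderiv ℝ (fderiv ℝ f) (c • x)).comp
      (c • ContinuousLinearMap.id ℝ (E n))) x :=
    (differentiableAt_fderiv (hf.contDiffAt (smul_ne_zero hc.ne' hx))).hasFDerivAt.comp x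
      ((hasFDerivAt_id x).const_smul c)
  have h2 : (fun y => fderiv ℝ f (c • y)) = fderiv ℝ f := by
    ext1 y; exact hf.fderiv_smul hc y
  rw [h2] at h1
  rw [h1.fderiv]
  ext v w
  simp [hc.ne']

/-- Differentiating Euler's identity. The radial direction lies in the kernel of the Hessian, so
only tangential directions carry information. -/
lemma fderiv_fderiv_self_right (hf : Hom2 f) {x : E n} (hx : x ≠ 0) (v : E n) :
    fderiv ℝ (fderiv ℝ f) x v x = 0 := by
  have h1 : HasFDerivAt (fun y => fderiv ℝ f y y) _ x :=
    (differentiableAt_fderiv (hf.contDiffAt hx)).hasFDerivAt.clm_apply (hasFDerivAt_id x)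
  have h2 : HasFDerivAt (fun y => fderiv ℝ f y y) (fderiv ℝ f x) x := by
    refine (hf.differentiableAt hx).hasFDerivAt.congr_of_eventuallyEq ?_
    filter_upwards [isOpen_compl_zero.mem_nhds hx] with y hy
    exact hf.fderiv_self hy
  have := DFunLike.congr_fun (h1.unique h2) v
  simpa using this

lemma fderiv_fderiv_self_left (hf : Hom2 f) {x : E n} (hx : x ≠ 0) (v : E n) :
    fderiv ℝ (fderiv ℝ f) x x v = 0 := by
  rw [fderiv_fderiv_symm (hf.contDiffAt hx), hf.fderiv_fderiv_self_right hx]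

end Hom2

lemma hom2_norm : Hom2 (fun y : E n => ‖y‖) :=
  ⟨fun _ hx => (contDiffAt_norm ℝ hx).contDiffWithinAt,
    fun c hc x => by rw [norm_smul, Real.norm_of_nonneg hc.le]⟩

lemma fderiv_norm_apply {x : E n} (hx : x ≠ 0) (v : E n) :
    fderiv ℝ (fun y : E n => ‖y‖) x v = ‖x‖⁻¹ * inner ℝ x v := by
  have h1 := (hom2_norm.differentiableAt hx).hasFDerivAt
  have h2 := h1.mul h1
  have h3 : ((fun y : E n => ‖y‖) * fun y => ‖y‖) = fun y => ‖y‖ ^ 2 := by ext y; simp; ring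
  rw [h3] at h2
  have h4 := DFunLike.congr_fun ((hasStrictFDerivAt_norm_sq x).hasFDerivAt.unique h2) v
  have h5 : ‖x‖ ≠ 0 := norm_ne_zero_iff.2 hx
  simp at h4
  field_simp
  linarith

/-- Obtained by differentiating `‖y‖ · D‖y‖ w = ⟨y, w⟩`. The norm is the 1-homogeneous extension of
the constant `1`, and its Hessian is the projection onto the tangent space. -/
lemma fderiv_fderiv_norm_apply {x : E n} (hx : ‖x‖ = 1) (v w : E n) :
    fderiv ℝ (fderiv ℝ (fun y : E n => ‖y‖)) x v w = inner ℝ v w - inner ℝ x v * inner ℝ x w := by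
  have hx0 : x ≠ 0 := by rintro rfl; simp at hx
  have h1 : HasFDerivAt (fun y => fderiv ℝ (fun y : E n => ‖y‖) y w)
      ((fderiv ℝ (fderiv ℝ (fun y : E n => ‖y‖)) x).flip w) x := by
    have := (differentiableAt_fderiv (hom2_norm.contDiffAt hx0)).hasFDerivAt.clm_apply
      (hasFDerivAt_const w x)
    convert! this using 1
    ext v; simp
  have h2 := h1.mul (hom2_norm.differentiableAt hx0).hasFDerivAt
  have h3 : HasFDerivAt (fun y : E n => inner ℝ y w) (innerSL ℝ w) x := by
    have := (innerSL ℝ w).hasFDerivAt (x := x)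
    refine this.congr_of_eventuallyEq (Eventually.of_forall fun y => ?_)
    simp [real_inner_comm]
  have h4 := DFunLike.congr_fun (h2.unique (h3.congr_of_eventuallyEq ?_)) v
  · simp only [hx, fderiv_norm_apply hx0, add_apply, smul_apply,
      ContinuousLinearMap.flip_apply, innerSL_apply_apply, smul_eq_mul, inv_one, one_mul] at h4
    rw [real_inner_comm]
    linarith
  · filter_upwards [isOpen_compl_zero.mem_nhds hx0] with y hy
    have : ‖y‖ ≠ 0 := norm_ne_zero_iff.2 hy
    rw [Pi.mul_apply, fderiv_norm_apply hy]
    field_simp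

/-! ### Functions on the sphere -/

/-- Functions on the sphere whose `0`-homogeneous extension is `C²` away from the origin. -/
def SphereC2 (u : S n → ℝ) : Prop := ContDiffOn ℝ 2 (ext0 u) {0}ᶜ

lemma ne_zero_of_sphere (x : S n) : (x : E n) ≠ 0 := ne_zero_of_mem_unit_sphere x

lemma norm_sphere (x : S n) : ‖(x : E n)‖ = 1 := by simp

/-- The radial projection onto the sphere. -/
def proj (y : E n) (hy : y ≠ 0) : S n :=
  ⟨‖y‖⁻¹ • y, by simp [norm_smul, inv_mul_cancel₀ (norm_ne_zero_iff.2 hy)]⟩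

lemma proj_sphere (x : S n) : proj (x : E n) (ne_zero_of_sphere x) = x := by
  ext1; simp [proj]

lemma ext0_of_ne (u : S n → ℝ) {y : E n} (hy : y ≠ 0) : ext0 u y = u (proj y hy) := by
  simp [ext0, hy, proj]

@[simp] lemma ext0_sphere (u : S n → ℝ) (x : S n) : ext0 u (x : E n) = u x := by
  rw [ext0_of_ne u (ne_zero_of_sphere x), proj_sphere]

lemma ext0_smul (u : S n → ℝ) {c : ℝ} (hc : 0 < c) (y : E n) : ext0 u (c • y) = ext0 u y := by
  rcases eq_or_ne y 0 with rfl | hy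
  · simp
  rw [ext0_of_ne u hy, ext0_of_ne u (smul_ne_zero hc.ne' hy)]
  congr 1
  ext1
  simp only [proj, norm_smul, Real.norm_of_nonneg hc.le, smul_smul]
  congr 1
  field_simp

lemma ext0_add (u v : S n → ℝ) : ext0 (fun x => u x + v x) = fun y => ext0 u y + ext0 v y := by
  ext y; by_cases hy : y = 0 <;> simp [ext0, hy]

lemma ext0_mul (u v : S n → ℝ) : ext0 (fun x => u x * v x) = fun y => ext0 u y * ext0 v y := by
  ext y; by_cases hy : y = 0 <;> simp [ext0, hy]

namespace SphereC2

variable {u v : S n → ℝ}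

lemma add (hu : SphereC2 u) (hv : SphereC2 v) : SphereC2 (fun x => u x + v x) := by
  rw [SphereC2, ext0_add]; exact ContDiffOn.add hu hv

lemma mul (hu : SphereC2 u) (hv : SphereC2 v) : SphereC2 (fun x => u x * v x) := by
  rw [SphereC2, ext0_mul]; exact ContDiffOn.mul hu hv

lemma const (c : ℝ) : SphereC2 (fun _ : S n => c) := by
  refine (contDiffOn_const (c := c)).congr fun y hy => ?_
  rw [ext0_of_ne _ hy]

lemma coord (i : Fin (n + 1)) : SphereC2 (fun x : S n => (x : E n) i) := by
  have : ContDiffOn ℝ 2 (fun y : E n => ‖y‖⁻¹ * y i) {0}ᶜ := by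
    refine ContDiffOn.mul (hom2_norm.contDiffOn.inv fun y hy => norm_ne_zero_iff.2 hy) ?_
    exact (contDiff_piLp_apply (p := 2) (i := i)).contDiffOn
  refine this.congr fun y hy => ?_
  rw [ext0_of_ne _ hy]
  simp [proj]

lemma continuous (hu : SphereC2 u) : Continuous u := by
  have : u = fun x : S n => ext0 u (x : E n) := by ext x; simp
  rw [this]
  exact hu.continuousOn.comp_continuous continuous_subtype_val ne_zero_of_sphere

lemma contDiffAt (hu : SphereC2 u) {x : E n} (hx : x ≠ 0) : ContDiffAt ℝ 2 (ext0 u) x :=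
  contDiffAt_of_compl_zero hu hx

end SphereC2

/-- The 0-homogeneous extension is `u` composed with the radial projection, a smooth map from the
open submanifold `{0}ᶜ` to the sphere. This turns the manifold notion of `C²` into the ambient one
used from here on. -/
lemma IsEvenC2.sphereC2 {u : S n → ℝ} (hu : IsEvenC2 u) : SphereC2 u := by
  have := Fact.mk (@finrank_euclideanSpace_fin ℝ _ (n + 1))
  let U : TopologicalSpace.Opens (E n) := ⟨{0}ᶜ, isOpen_compl_zero⟩
  have h1 : ContMDiff 𝓘(ℝ, E n) 𝓘(ℝ, E n) 2 (fun y : U => ‖(y : E n)‖⁻¹ • (y : E n)) := by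
    intro y
    have hy : (y : E n) ≠ 0 := y.2
    refine (contMDiffAt_subtype_iff (f := fun y : E n => ‖y‖⁻¹ • y)).2 ?_
    exact (((contDiffAt_norm ℝ hy).inv (norm_ne_zero_iff.2 hy)).smul contDiffAt_id).contMDiffAt
  have h2 := ContMDiff.codRestrict_sphere (n := n) h1 (fun y => (proj (y : E n) y.2).2)
  have h3 := hu.1.comp h2
  refine contDiffOn_compl_zero fun x hx => ?_
  have h4 : ContMDiffAt 𝓘(ℝ, E n) 𝓘(ℝ, ℝ) 2 (fun y : U => ext0 u (y : E n)) ⟨x, hx⟩ := by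
    convert! h3 ⟨x, hx⟩ using 1
    ext y
    rw [ext0_of_ne u y.2]
    rfl
  exact (contMDiffAt_subtype_iff.1 h4).contDiffAt

/-- The `1`-homogeneous extension of a function on the sphere. -/
def ext1 (u : S n → ℝ) (y : E n) : ℝ := ext0 u y * ‖y‖

@[simp] lemma ext1_sphere (u : S n → ℝ) (x : S n) : ext1 u (x : E n) = u x := by
  simp [ext1]

lemma SphereC2.hom2_ext1 {u : S n → ℝ} (hu : SphereC2 u) : Hom2 (ext1 u) :=
  ⟨ContDiffOn.mul hu hom2_norm.contDiffOn, fun c hc x => by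
    rw [ext1, ext1, ext0_smul u hc, norm_smul, Real.norm_of_nonneg hc.le]; ring⟩

/-- The polarity between the gradient square and the Hessians of `u²`, `u` and `1`. -/
lemma fderiv_ext0_mul_fderiv_ext0 {u : S n → ℝ} (hu : SphereC2 u) (x : S n) (v w : E n) :
    fderiv ℝ (ext0 u) x v * fderiv ℝ (ext0 u) x w
      = (1 / 2) * fderiv ℝ (fderiv ℝ (ext1 fun x => u x * u x)) x v w
        - u x * fderiv ℝ (fderiv ℝ (ext1 u)) x v w
        + (1 / 2) * u x ^ 2 * fderiv ℝ (fderiv ℝ (fun y : E n => ‖y‖)) x v w := by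
  have hx := ne_zero_of_sphere x
  have h1 : (ext1 fun x => u x * u x) = fun y => ext0 u y * ext1 u y := by
    ext y; rw [ext1, ext0_mul, ext1]; ring
  have h2 : ext1 u = fun y => ext0 u y * ‖y‖ := rfl
  have h3 : ∀ v, fderiv ℝ (ext1 u) x v
      = ext0 u x * fderiv ℝ (fun y : E n => ‖y‖) x v + ‖(x : E n)‖ * fderiv ℝ (ext0 u) x v := by
    intro v
    rw [h2, fderiv_fun_mul ((hu.contDiffAt hx).differentiableAt (by norm_num))
      (hom2_norm.differentiableAt hx)]
    simp
  rw [h1, fderiv_fderiv_mul (hu.contDiffAt hx) (hu.hom2_ext1.contDiffAt hx), h3, h3, h2,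
    fderiv_fderiv_mul (hu.contDiffAt hx) (hom2_norm.contDiffAt hx)]
  simp only [ext0_sphere, norm_sphere]
  ring

/-! ### Support functions -/

section SupportFunction

open scoped Pointwise

variable (K L : ConvexBody (E n))

lemma bddAbove_inner_image (x : E n) :
    BddAbove ((fun y : E n => inner ℝ x y) '' (K : Set (E n))) :=
  (K.isCompact.image (by fun_prop)).bddAbove

lemma inner_le_supp {y : E n} (hy : y ∈ K) (x : E n) : inner ℝ x y ≤ supp K x :=
  le_csSup (bddAbove_inner_image K x) ⟨y, hy, rfl⟩

lemma exists_inner_eq_supp (x : E n) : ∃ y ∈ K, inner ℝ x y = supp K x :=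
  (K.isCompact.image (f := fun y : E n => inner ℝ x y) (by fun_prop)).sSup_mem
    (K.nonempty.image _)

variable {K L}

lemma supp_le {x : E n} {c : ℝ} (h : ∀ y ∈ K, inner ℝ x y ≤ c) : supp K x ≤ c := by
  obtain ⟨y, hy, h'⟩ := exists_inner_eq_supp K x
  exact h' ▸ h y hy

lemma supp_eq_of_forall {x y : E n} (hy : y ∈ K) (h : ∀ z ∈ K, inner ℝ x z ≤ inner ℝ x y) :
    supp K x = inner ℝ x y :=
  le_antisymm (supp_le h) (inner_le_supp K hy x)

variable (K L)

lemma supp_zero : supp K 0 = 0 := by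
  obtain ⟨y, -, h⟩ := exists_inner_eq_supp K 0
  rw [← h, inner_zero_left]

lemma supp_smul {c : ℝ} (hc : 0 ≤ c) (x : E n) : supp K (c • x) = c * supp K x := by
  obtain ⟨y, hy, h⟩ := exists_inner_eq_supp K x
  rw [supp_eq_of_forall hy, real_inner_smul_left, h]
  intro z hz
  rw [real_inner_smul_left, real_inner_smul_left, h]
  exact mul_le_mul_of_nonneg_left (inner_le_supp K hz x) hc

lemma supp_add_le (x y : E n) : supp K (x + y) ≤ supp K x + supp K y :=
  supp_le fun z hz => by
    rw [inner_add_left]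
    exact add_le_add (inner_le_supp K hz x) (inner_le_supp K hz y)

lemma supp_add_body (x : E n) : supp (K + L) x = supp K x + supp L x := by
  refine le_antisymm (supp_le fun z hz => ?_) ?_
  · obtain ⟨a, ha, b, hb, rfl⟩ := Set.mem_add.1 (show z ∈ (K : Set (E n)) + (L : Set (E n)) from hz)
    rw [inner_add_right]
    exact add_le_add (inner_le_supp K ha x) (inner_le_supp L hb x)
  · obtain ⟨a, ha, h1⟩ := exists_inner_eq_supp K x
    obtain ⟨b, hb, h2⟩ := exists_inner_eq_supp L x
    rw [← h1, ← h2, ← inner_add_right]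
    exact inner_le_supp _ (show a + b ∈ (K : Set (E n)) + (L : Set (E n)) from Set.add_mem_add ha hb) x

lemma supp_smul_body {c : ℝ} (hc : 0 ≤ c) (x : E n) : supp (c • K) x = c * supp K x := by
  refine le_antisymm (supp_le fun z hz => ?_) ?_
  · obtain ⟨a, ha, rfl⟩ := Set.mem_smul_set.1 (show z ∈ c • (K : Set (E n)) from hz)
    rw [real_inner_smul_right]
    exact mul_le_mul_of_nonneg_left (inner_le_supp K ha x) hc
  · obtain ⟨a, ha, h1⟩ := exists_inner_eq_supp K x
    rw [← h1, ← real_inner_smul_right]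
    exact inner_le_supp _ (show c • a ∈ c • (K : Set (E n)) from Set.smul_mem_smul_set ha) x

lemma supp_add_smul_body {c : ℝ} (hc : 0 ≤ c) (x : E n) :
    supp (K + c • L) x = supp K x + c * supp L x := by
  rw [supp_add_body, supp_smul_body L hc]

variable {K L}

/-- Hahn–Banach separation of a point from a closed convex set. -/
lemma mem_iff_forall_inner_le_supp {p : E n} : p ∈ K ↔ ∀ x, inner ℝ x p ≤ supp K x := by
  refine ⟨fun h x => inner_le_supp K h x, fun h => ?_⟩
  by_contra hp
  obtain ⟨f, u, h1, h2⟩ := geometric_hahn_banach_closed_point K.convex K.isClosed hp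
  set x := (InnerProductSpace.toDual ℝ (E n)).symm f
  have hx : ∀ y, inner ℝ x y = f y := fun y => InnerProductSpace.toDual_symm_apply
  obtain ⟨y, hy, h3⟩ := exists_inner_eq_supp K x
  have := h x
  rw [← h3, hx, hx] at this
  linarith [h1 y hy]

lemma le_of_supp_le (h : ∀ x, supp K x ≤ supp L x) : (K : Set (E n)) ⊆ L := fun _ hp =>
  mem_iff_forall_inner_le_supp.2 fun x => (inner_le_supp K hp x).trans (h x)

lemma exists_mem_dist_le (K L : ConvexBody (E n)) {x : E n} (hx : x ∈ K) :
    ∃ y ∈ L, dist x y ≤ dist K L := by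
  obtain ⟨y, hy, h⟩ := L.isCompact.exists_infDist_eq_dist L.nonempty x
  exact ⟨y, hy, h ▸ infDist_le_hausdorffDist_of_mem hx ConvexBody.hausdorffEDist_ne_top⟩

lemma supp_le_supp_add_dist (K L : ConvexBody (E n)) (x : E n) :
    supp K x ≤ supp L x + dist K L * ‖x‖ := by
  refine supp_le fun y hy => ?_
  obtain ⟨z, hz, h⟩ := exists_mem_dist_le K L hy
  have h1 : inner ℝ x y = inner ℝ x z + inner ℝ x (y - z) := by rw [← inner_add_right]; simp
  have h2 := real_inner_le_norm x (y - z)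
  rw [dist_eq_norm] at h
  have h3 := mul_le_mul_of_nonneg_left h (norm_nonneg x)
  linarith [inner_le_supp L hz x]

lemma abs_supp_sub_supp_le (K L : ConvexBody (E n)) (x : E n) :
    |supp K x - supp L x| ≤ dist K L * ‖x‖ := by
  rw [abs_sub_le_iff]
  have h1 := supp_le_supp_add_dist K L x
  have h2 := supp_le_supp_add_dist L K x
  rw [dist_comm] at h2
  constructor <;> linarith

lemma mul_norm_le_supp {r : ℝ} (hr : 0 ≤ r) (h : closedBall (0 : E n) r ⊆ K) (x : E n) :
    r * ‖x‖ ≤ supp K x := by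
  rcases eq_or_ne x 0 with rfl | hx
  · simp [supp_zero]
  have h1 : (r * ‖x‖⁻¹) • x ∈ K := h <| by
    rw [mem_closedBall_zero_iff, norm_smul, norm_mul, norm_inv, norm_norm, mul_assoc,
      inv_mul_cancel₀ (norm_ne_zero_iff.2 hx), mul_one, Real.norm_of_nonneg hr]
  have h2 := inner_le_supp K h1 x
  rw [real_inner_smul_right, real_inner_self_eq_norm_sq] at h2
  have : ‖x‖ ≠ 0 := norm_ne_zero_iff.2 hx
  field_simp at h2
  linarith

lemma exists_closedBall_subset (h : (0 : E n) ∈ interior (K : Set (E n))) :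
    ∃ r > 0, closedBall (0 : E n) r ⊆ K :=
  nhds_basis_closedBall.mem_iff.1 (mem_interior_iff_mem_nhds.1 h)

lemma supp_pos (h : (0 : E n) ∈ interior (K : Set (E n))) {x : E n} (hx : x ≠ 0) :
    0 < supp K x := by
  obtain ⟨r, hr, hK⟩ := exists_closedBall_subset h
  exact lt_of_lt_of_le (mul_pos hr (norm_pos_iff.2 hx)) (mul_norm_le_supp hr.le hK x)

lemma supp_nonneg (h : (0 : E n) ∈ K) (x : E n) : 0 ≤ supp K x := by
  simpa using inner_le_supp K h x

lemma continuous_supp (K : ConvexBody (E n)) : Continuous (supp K) := by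
  obtain ⟨R, hR⟩ := K.isBounded.exists_norm_le
  have key : ∀ x y, supp K x - supp K y ≤ R * dist x y := fun x y => by
    have h1 := supp_add_le K (x - y) y
    rw [sub_add_cancel] at h1
    have h2 : supp K (x - y) ≤ R * dist x y := supp_le fun z hz => by
      rw [dist_eq_norm, mul_comm]
      exact (real_inner_le_norm _ _).trans (mul_le_mul_of_nonneg_left (hR z hz) (norm_nonneg _))
    linarith
  refine (LipschitzWith.of_dist_le' (K := R) fun x y => ?_).continuous
  rw [Real.dist_eq, abs_sub_le_iff]
  exact ⟨key x y, dist_comm x y ▸ key y x⟩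

lemma IsEvenBody.zero_mem_interior (h : IsEvenBody K) : (0 : E n) ∈ interior (K : Set (E n)) := by
  obtain ⟨⟨x, hx⟩, hs⟩ := h
  rw [mem_interior_iff_mem_nhds, Metric.mem_nhds_iff] at hx ⊢
  obtain ⟨r, hr, hK⟩ := hx
  refine ⟨r, hr, fun z hz => ?_⟩
  rw [mem_ball_zero_iff] at hz
  have h1 : x + z ∈ (K : Set (E n)) := hK (by simpa using hz)
  have h2 : -(x - z) ∈ (K : Set (E n)) := hs _ (hK (by simpa using hz))
  -- With a ball around `x` inside `K`, `z` is the midpoint of `x + z` and `-(x - z)`.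
  have h3 := K.convex h1 h2 (a := 1 / 2) (b := 1 / 2) (by norm_num) (by norm_num) (by norm_num)
  convert h3 using 1
  module

lemma subset_add_smul {c : ℝ} (hc : 0 ≤ c) (hL : (0 : E n) ∈ L) :
    (K : Set (E n)) ⊆ (K + c • L : ConvexBody (E n)) :=
  le_of_supp_le fun x => by
    rw [supp_add_smul_body K L hc]
    nlinarith [supp_nonneg hL x]

lemma zero_mem_interior_add_smul {c : ℝ} (hc : 0 ≤ c) (hK : (0 : E n) ∈ interior (K : Set (E n)))
    (hL : (0 : E n) ∈ L) : (0 : E n) ∈ interior ((K + c • L : ConvexBody (E n)) : Set (E n)) :=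
  interior_mono (subset_add_smul hc hL) hK

lemma continuous_add_body (L : ConvexBody (E n)) :
    Continuous fun K : ConvexBody (E n) => K + L := by
  have key : ∀ K K' : ConvexBody (E n), ∀ x ∈ ((K + L : ConvexBody (E n)) : Set (E n)),
      ∃ y ∈ ((K' + L : ConvexBody (E n)) : Set (E n)), dist x y ≤ dist K K' := by
    intro K K' x hx
    obtain ⟨a, ha, b, hb, rfl⟩ := Set.mem_add.1 (show x ∈ (K : Set (E n)) + (L : Set (E n)) from hx)
    obtain ⟨c, hc, h⟩ := exists_mem_dist_le K K' ha
    exact ⟨c + b, show c + b ∈ (K' : Set (E n)) + (L : Set (E n)) from Set.add_mem_add hc hb, by simpa using h⟩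
  refine (LipschitzWith.of_dist_le_mul (K := 1) fun K K' => ?_).continuous
  rw [NNReal.coe_one, one_mul]
  refine hausdorffDist_le_of_mem_dist dist_nonneg (key K K') fun x hx => ?_
  rw [dist_comm K K']
  exact key K' K x hx

end SupportFunction

/-! ### Continuity of the volume -/

/-- The volume of a convex body. -/
def vol (K : ConvexBody (E n)) : ℝ := (volume : Measure (E n)).real (K : Set (E n))

lemma vol_smul {c : ℝ} (hc : 0 ≤ c) (K : ConvexBody (E n)) : vol (c • K) = c ^ (n + 1) * vol K := by
  rw [vol, vol, ConvexBody.coe_smul, measureReal_def, Measure.addHaar_smul, ENNReal.toReal_mul,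
    ENNReal.toReal_ofReal (abs_nonneg _), finrank_euclideanSpace_fin, abs_of_nonneg (pow_nonneg hc _),
    measureReal_def]

lemma vol_mono {K L : ConvexBody (E n)} (h : (K : Set (E n)) ⊆ L) : vol K ≤ vol L :=
  measureReal_mono h L.isCompact.measure_ne_top

lemma vol_pos {K : ConvexBody (E n)} (h : (interior (K : Set (E n))).Nonempty) : 0 < vol K :=
  ENNReal.toReal_pos (Measure.measure_pos_of_nonempty_interior _ h).ne' K.isCompact.measure_ne_top

/-- If `K` contains the ball of radius `r` and `d` is the distance to `K'`, then `d ‖x‖ ≤ (d/r)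
h_K(x)`. Hence `(1 - d/r) K ⊆ K' ⊆ (1 + d/r) K` for `d ≤ r`, and the volume is homogeneous of degree
`n + 1`. -/
lemma continuousAt_vol {K : ConvexBody (E n)} (h : (0 : E n) ∈ interior (K : Set (E n))) :
    ContinuousAt vol K := by
  obtain ⟨r, hr, hK⟩ := exists_closedBall_subset h
  have hd : Tendsto (fun K' => dist K' K / r) (𝓝 K) (𝓝 0) := by
    have : Continuous fun K' => dist K' K / r := by fun_prop
    simpa using this.tendsto K
  have h1 : Tendsto (fun K' => (1 - dist K' K / r) ^ (n + 1) * vol K) (𝓝 K) (𝓝 (vol K)) := by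
    simpa using ((hd.const_sub 1).pow (n + 1)).mul_const (vol K)
  have h2 : Tendsto (fun K' => (1 + dist K' K / r) ^ (n + 1) * vol K) (𝓝 K) (𝓝 (vol K)) := by
    simpa using ((hd.const_add 1).pow (n + 1)).mul_const (vol K)
  have key : ∀ K' x, dist K' K * ‖x‖ ≤ dist K' K / r * supp K x := fun K' x => by
    have := mul_le_mul_of_nonneg_left (mul_norm_le_supp hr.le hK x)
      (div_nonneg (dist_nonneg (x := K') (y := K)) hr.le)
    field_simp at this ⊢
    linarith
  refine tendsto_of_tendsto_of_tendsto_of_le_of_le' h1 h2 ?_ ?_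
  · filter_upwards [hd.eventually (ge_mem_nhds zero_lt_one)] with K' hK'
    rw [← vol_smul (sub_nonneg.2 hK')]
    refine vol_mono (le_of_supp_le fun x => ?_)
    rw [supp_smul_body _ (sub_nonneg.2 hK')]
    have h3 := supp_le_supp_add_dist K K' x
    rw [dist_comm] at h3
    linarith [key K' x]
  · refine Eventually.of_forall fun K' => ?_
    have h0 : 0 ≤ 1 + dist K' K / r := by positivity
    rw [← vol_smul h0]
    refine vol_mono (le_of_supp_le fun x => ?_)
    rw [supp_smul_body _ h0]
    linarith [key K' x, supp_le_supp_add_dist K' K x]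

lemma continuousAt_vol_add_smul {K L : ConvexBody (E n)} {c : ℝ} (hc : 0 ≤ c)
    (hK : (0 : E n) ∈ interior (K : Set (E n))) (hL : (0 : E n) ∈ L) :
    ContinuousAt (fun K : ConvexBody (E n) => vol (K + c • L)) K :=
  ContinuousAt.comp (f := fun K : ConvexBody (E n) => K + c • L)
    (continuousAt_vol (zero_mem_interior_add_smul hc hK hL))
    (continuous_add_body (c • L)).continuousAt

/-! ### Extraction of coefficients of polynomials -/

/-- Lagrange interpolation at the nodes `0, …, N`. The weights do not depend on `p`, so they can be
pulled out of integrals over the sphere. -/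
lemma exists_coeff_one_weights (N : ℕ) : ∃ c : ℕ → ℝ, ∀ p : Polynomial ℝ, p.natDegree ≤ N →
    p.coeff 1 = ∑ j ∈ Finset.range (N + 1), c j * p.eval (j : ℝ) := by
  refine ⟨fun j => (Lagrange.basis (Finset.range (N + 1)) (fun j : ℕ => (j : ℝ)) j).coeff 1,
    fun p hp => ?_⟩
  have h := Lagrange.eq_interpolate (s := Finset.range (N + 1)) (v := fun j : ℕ => (j : ℝ))
    (f := p) (fun a _ b _ h => by simpa using h) (by
      rw [Finset.card_range]
      exact lt_of_le_of_lt Polynomial.degree_le_natDegree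
        (by exact_mod_cast Nat.lt_succ_of_le hp))
  conv_lhs => rw [h, Lagrange.interpolate_apply, Polynomial.finsetSum_coeff]
  refine Finset.sum_congr rfl fun j _ => ?_
  rw [Polynomial.coeff_C_mul, mul_comm]

/-- The value at `0` is the linear coefficient of the primitive, whose degree is one higher; hence
`N + 2` nodes. -/
lemma exists_eval_zero_weights (N : ℕ) : ∃ c : ℕ → ℝ, ∀ p : Polynomial ℝ, p.natDegree ≤ N →
    p.eval 0 = ∑ j ∈ Finset.range (N + 2), c j * ∫ s in (0 : ℝ)..j, p.eval s := by
  obtain ⟨c, hc⟩ := exists_coeff_one_weights (N + 1)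
  refine ⟨c, fun p hp => ?_⟩
  have h1 : ∀ t : ℝ, ∫ s in (0 : ℝ)..t, p.eval s
      = ∑ m ∈ Finset.range (N + 1), p.coeff m * (t ^ (m + 1) / (m + 1)) := by
    intro t
    simp_rw [Polynomial.eval_eq_sum_range' (Nat.lt_succ_of_le hp)]
    rw [intervalIntegral.integral_finsetSum fun m _ =>
      (by fun_prop : Continuous fun s : ℝ => p.coeff m * s ^ m).intervalIntegrable _ _]
    refine Finset.sum_congr rfl fun m _ => ?_
    simp
  simp_rw [h1, Finset.mul_sum]
  rw [Finset.sum_comm]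
  have h2 : ∀ m ∈ Finset.range (N + 1), ∑ j ∈ Finset.range (N + 2),
      c j * (p.coeff m * ((j : ℝ) ^ (m + 1) / (m + 1))) = if m = 0 then p.coeff 0 else 0 := by
    intro m hm
    -- On the monomial `X^(m+1)` the weights return its linear coefficient, which is nonzero only
    -- for `m = 0`.
    have h3 := hc (Polynomial.X ^ (m + 1)) (by
      rw [Polynomial.natDegree_X_pow]; exact Finset.mem_range.1 hm)
    simp only [Polynomial.coeff_X_pow, Polynomial.eval_pow, Polynomial.eval_X] at h3
    have h4 : ∑ j ∈ Finset.range (N + 2), c j * (p.coeff m * ((j : ℝ) ^ (m + 1) / (m + 1)))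
        = p.coeff m / (m + 1) * ∑ j ∈ Finset.range (N + 2), c j * (j : ℝ) ^ (m + 1) := by
      rw [Finset.mul_sum]
      exact Finset.sum_congr rfl fun j _ => by ring
    rw [h4, ← h3]
    rcases eq_or_ne m 0 with rfl | hm0
    · simp
    · simp [hm0]
  rw [Finset.sum_congr rfl h2, Polynomial.coeff_zero_eq_eval_zero]
  simp

/-! ### Determinants -/

lemma exists_det_polynomial (M N : Matrix (Fin (n + 1)) (Fin (n + 1)) ℝ) :
    ∃ p : Polynomial ℝ, p.natDegree ≤ n + 1 ∧ ∀ s, p.eval s = (M + s • N).det := by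
  refine ⟨(((Polynomial.X : Polynomial ℝ) • N.map Polynomial.C + M.map Polynomial.C)).det,
    by simpa using Polynomial.natDegree_det_X_add_C_le N M, fun s => ?_⟩
  rw [← Polynomial.coe_evalRingHom, RingHom.map_det]
  congr 1
  ext i j
  simp [add_comm]
  exact mul_comm _ _

/-- Jacobi's formula: factor out `M` and use that the linear coefficient of `det (1 + X Q)` is the
trace of `Q`. -/
lemma coeff_one_of_eval_eq_det {M N : Matrix (Fin (n + 1)) (Fin (n + 1)) ℝ} (hM : M.det ≠ 0)
    {p : Polynomial ℝ} (hp : ∀ s, p.eval s = (M + s • N).det) :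
    p.coeff 1 = (M.adjugate * N).trace := by
  have h1 : p = Polynomial.C M.det
      * (1 + (Polynomial.X : Polynomial ℝ) • (M⁻¹ * N).map Polynomial.C).det := by
    refine Polynomial.funext fun s => ?_
    rw [hp, Polynomial.eval_mul, Polynomial.eval_C, ← Polynomial.coe_evalRingHom,
      RingHom.map_det]
    have h2 : M + s • N = M * (1 + s • (M⁻¹ * N)) := by
      rw [mul_add, mul_one, mul_smul_comm, ← mul_assoc, Matrix.mul_nonsing_inv _ hM.isUnit,
        one_mul]
    rw [h2, Matrix.det_mul]
    congr 2
    generalize M⁻¹ * N = Q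
    ext i j
    by_cases hij : i = j <;> simp [hij] <;> exact mul_comm _ _
  rw [h1, Polynomial.coeff_C_mul, Matrix.coeff_det_one_add_X_smul_one, Matrix.inv_def,
    Ring.inverse_eq_inv', Matrix.smul_mul, Matrix.trace_smul, smul_eq_mul, ← mul_assoc,
    mul_inv_cancel₀ hM, one_mul]

lemma det_one_add_vecMulVec' (u v : Fin (n + 1) → ℝ) :
    (1 + Matrix.vecMulVec u v).det = 1 + v ⬝ᵥ u := by
  rw [Matrix.vecMulVec_eq Unit, Matrix.det_one_add_replicateCol_mul_replicateRow]

/-- Since `xᵀ A = 0`, left multiplication by rank-one perturbations of the identity changes only the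
summand with `xᵀ`: one factor, of determinant `x ⬝ v`, trades `x` for `v`; another, of determinant
`s`, corrects the scaling in the direction of `x`. -/
lemma det_inv_smul_add_vecMulVec {A : Matrix (Fin (n + 1)) (Fin (n + 1)) ℝ}
    {x v : Fin (n + 1) → ℝ} (hA : x ᵥ* A = 0) (hx : x ⬝ᵥ x = 1) {s : ℝ} (hs : s ≠ 0) :
    (s⁻¹ • A + Matrix.vecMulVec v x).det
      = s⁻¹ ^ n * (x ⬝ᵥ v) * (A + Matrix.vecMulVec x x).det := by
  have h1 : s⁻¹ • A + Matrix.vecMulVec v x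
      = (1 + Matrix.vecMulVec (v - x) x) * (s⁻¹ • A + Matrix.vecMulVec x x) := by
    rw [add_mul, one_mul, mul_add, mul_smul_comm, Matrix.vecMulVec_mul, hA,
      Matrix.vecMulVec_mul_vecMulVec, hx, Matrix.sub_vecMulVec]
    ext i j
    simp [Matrix.vecMulVec_apply]
    ring
  have h2 : s⁻¹ • A + Matrix.vecMulVec x x
      = s⁻¹ • ((1 + Matrix.vecMulVec ((s - 1) • x) x) * (A + Matrix.vecMulVec x x)) := by
    rw [add_mul, one_mul, mul_add, Matrix.vecMulVec_mul, hA,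
      Matrix.vecMulVec_mul_vecMulVec, hx, Matrix.smul_vecMulVec]
    ext i j
    simp
    field_simp
    ring
  rw [h1, Matrix.det_mul, h2, Matrix.det_smul, Matrix.det_mul, det_one_add_vecMulVec',
    det_one_add_vecMulVec', dotProduct_sub, hx, dotProduct_smul, hx, Fintype.card_fin, pow_succ]
  simp
  field_simp

/-! ### Hessian matrices -/

/-- The matrix of the second derivative in the standard basis. -/
def hessMat (f : E n → ℝ) (x : E n) : Matrix (Fin (n + 1)) (Fin (n + 1)) ℝ :=
  Matrix.of fun i j =>
    fderiv ℝ (fderiv ℝ f) x (EuclideanSpace.single i 1) (EuclideanSpace.single j 1)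

lemma bodyMatrix_eq (K : ConvexBody (E n)) (x : S n) :
    bodyMatrix K x = hessMat (supp K) x + Matrix.vecMulVec (x : E n) (x : E n) := rfl

lemma eq_sum_single (v : E n) : v = ∑ i, v i • EuclideanSpace.single i (1 : ℝ) := by
  simpa using ((EuclideanSpace.basisFun (Fin (n + 1)) ℝ).sum_repr v).symm

lemma dotProduct_hessMat_mulVec (f : E n → ℝ) (x v w : E n) :
    (v : Fin (n + 1) → ℝ) ⬝ᵥ (hessMat f x *ᵥ w) = fderiv ℝ (fderiv ℝ f) x v w := by
  conv_rhs => rw [eq_sum_single v, eq_sum_single w]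
  simp only [map_sum, map_smul, sum_apply, smul_apply, dotProduct, Matrix.mulVec, hessMat,
    Matrix.of_apply, smul_eq_mul]
  simp only [Finset.mul_sum]
  refine Finset.sum_comm.trans (Finset.sum_congr rfl fun j _ => Finset.sum_congr rfl fun i _ => ?_)
  ring

lemma hessMat_add {f g : E n → ℝ} {x : E n} (hf : ContDiffAt ℝ 2 f x) (hg : ContDiffAt ℝ 2 g x) :
    hessMat (fun y => f y + g y) x = hessMat f x + hessMat g x := by
  ext i j; simp [hessMat, fderiv_fderiv_add hf hg]

lemma hessMat_const_mul {f : E n → ℝ} {x : E n} (c : ℝ) (hf : ContDiffAt ℝ 2 f x) :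
    hessMat (fun y => c * f y) x = c • hessMat f x := by
  ext i j; simp [hessMat, fderiv_fderiv_const_mul c hf]

lemma continuous_hessMat {f : E n → ℝ} (hf : Hom2 f) :
    Continuous fun x : S n => hessMat f (x : E n) := by
  have h : Continuous fun x : S n => fderiv ℝ (fderiv ℝ f) (x : E n) :=
    continuous_iff_continuousAt.2 fun x =>
      ContinuousAt.comp (f := fun x : S n => (x : E n))
        (continuousAt_fderiv_fderiv (hf.contDiffAt (ne_zero_of_sphere x)))
        continuous_subtype_val.continuousAt
  refine continuous_matrix fun i j => ?_
  exact (h.clm_apply continuous_const).clm_apply continuous_const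

lemma vecMul_hessMat {f : E n → ℝ} (hf : Hom2 f) (x : S n) :
    ((x : E n) : Fin (n + 1) → ℝ) ᵥ* hessMat f x = 0 := by
  refine dotProduct_eq_zero _ fun w => ?_
  rw [← Matrix.dotProduct_mulVec]
  have := dotProduct_hessMat_mulVec f x x (WithLp.toLp 2 w)
  rw [hf.fderiv_fderiv_self_left (ne_zero_of_sphere x)] at this
  exact this

lemma inner_eq_dotProduct (v w : E n) : inner ℝ v w = (v : Fin (n + 1) → ℝ) ⬝ᵥ w := by
  rw [PiLp.inner_apply]
  simp [dotProduct, mul_comm]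

lemma dotProduct_self_sphere (x : S n) :
    ((x : E n) : Fin (n + 1) → ℝ) ⬝ᵥ (x : E n) = 1 := by
  rw [← inner_eq_dotProduct, real_inner_self_eq_norm_sq, norm_sphere]
  norm_num

/-- Bodies with `C²` support function and positive definite `∇²h + h Id`, not necessarily even. -/
structure C2Plus (K : ConvexBody (E n)) : Prop where
  contDiffOn : ContDiffOn ℝ 2 (supp K) {0}ᶜ
  pos : ∀ x v : E n, ‖x‖ = 1 → inner ℝ x v = 0 → v ≠ 0 → 0 < hess K x v v

lemma IsEvenC2Plus.c2Plus {K : ConvexBody (E n)} (h : IsEvenC2Plus K) : C2Plus K := ⟨h.2.1, h.2.2⟩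

namespace C2Plus

variable {K L : ConvexBody (E n)}

lemma hom2 (hK : C2Plus K) : Hom2 (supp K) :=
  ⟨hK.contDiffOn, fun _ hc x => supp_smul K hc.le x⟩

lemma add_smul (hK : C2Plus K) (hL : C2Plus L) {c : ℝ} (hc : 0 ≤ c) : C2Plus (K + c • L) := by
  have h : supp (K + c • L) = fun x => supp K x + c * supp L x :=
    funext fun x => supp_add_smul_body K L hc x
  refine ⟨h ▸ (hK.hom2.add (hL.hom2.const_mul c)).contDiffOn, fun x v hx hv hv0 => ?_⟩
  have hx0 : x ≠ 0 := by rintro rfl; simp at hx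
  rw [hess, h, fderiv_fderiv_add (hK.hom2.contDiffAt hx0) ((hL.hom2.const_mul c).contDiffAt hx0),
    fderiv_fderiv_const_mul c (hL.hom2.contDiffAt hx0)]
  have h1 := hK.pos x v hx hv hv0
  have h2 := hL.pos x v hx hv hv0
  rw [hess] at h1 h2
  simp only [add_apply, smul_apply, smul_eq_mul]
  positivity

lemma bodyMatrix_add_smul (hK : C2Plus K) (hL : C2Plus L) {c : ℝ} (hc : 0 ≤ c) (x : S n) :
    bodyMatrix (K + c • L) x = bodyMatrix K x + c • hessMat (supp L) x := by
  have h : supp (K + c • L) = fun x => supp K x + c * supp L x :=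
    funext fun x => supp_add_smul_body K L hc x
  have hx0 := ne_zero_of_sphere x
  rw [bodyMatrix_eq, h, hessMat_add (hK.hom2.contDiffAt hx0)
    ((hL.hom2.const_mul c).contDiffAt hx0), hessMat_const_mul c (hL.hom2.contDiffAt hx0),
    bodyMatrix_eq]
  abel

/-- Write `V = a x + w` with `w` tangential. The radial part drops out of the Hessian, so the form
is `D²h(w, w) + a²`, and `w`, `a` do not both vanish. -/
lemma posDef_bodyMatrix (hK : C2Plus K) (x : S n) : (bodyMatrix K x).PosDef := by
  have hx0 := ne_zero_of_sphere x
  refine Matrix.PosDef.of_dotProduct_mulVec_pos ?_ fun v hv => ?_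
  · ext i j
    simp only [bodyMatrix_eq, Matrix.conjTranspose_apply, Matrix.add_apply, hessMat,
      Matrix.of_apply, star_trivial, Matrix.vecMulVec_apply]
    rw [fderiv_fderiv_symm (hK.hom2.contDiffAt hx0), mul_comm]
  · set V : E n := WithLp.toLp 2 v
    have h1 : star v ⬝ᵥ (bodyMatrix K x *ᵥ v)
        = fderiv ℝ (fderiv ℝ (supp K)) x V V + inner ℝ (x : E n) V ^ 2 := by
      rw [bodyMatrix_eq, Matrix.add_mulVec, dotProduct_add, ← dotProduct_hessMat_mulVec,
        Matrix.vecMulVec_mulVec, inner_eq_dotProduct]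
      simp only [V, star_trivial, dotProduct_smul, op_smul_eq_smul, smul_eq_mul]
      rw [dotProduct_comm v ((x : E n) : Fin (n + 1) → ℝ)]
      ring
    rw [h1]
    set a := inner ℝ (x : E n) V with ha
    have hxx : inner ℝ (x : E n) (x : E n) = 1 := by
      rw [real_inner_self_eq_norm_sq, norm_sphere]; norm_num
    have h2 : fderiv ℝ (fderiv ℝ (supp K)) x V V = hess K x (V - a • (x : E n)) (V - a • (x : E n)) := by
      simp [hess, hK.hom2.fderiv_fderiv_self_left hx0, hK.hom2.fderiv_fderiv_self_right hx0]
    have h3 : inner ℝ (x : E n) (V - a • (x : E n)) = 0 := by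
      rw [inner_sub_right, real_inner_smul_right, hxx]; ring
    rw [h2]
    by_cases h4 : V - a • (x : E n) = 0
    · have ha0 : a ≠ 0 := by
        rintro h0
        rw [h0, zero_smul, sub_zero] at h4
        exact hv (by simpa [V] using h4)
      rw [h4]
      simp only [hess, map_zero, zero_add]
      positivity
    · have := hK.pos x _ (norm_sphere x) h3 h4
      positivity

lemma detH_pos (hK : C2Plus K) (x : S n) : 0 < detH K x := (hK.posDef_bodyMatrix x).det_pos

end C2Plus

/-! ### Gradients of support functions -/

/-- The function `h_K - ⟨p, ·⟩` is nonnegative and vanishes at `x`, so its derivative there is zero.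
-/
lemma gradient_supp_eq {K : ConvexBody (E n)} {x p : E n} (hd : DifferentiableAt ℝ (supp K) x)
    (hp : p ∈ K) (h : inner ℝ x p = supp K x) : gradient (supp K) x = p := by
  have h1 : HasFDerivAt (fun y => supp K y - innerSL ℝ p y) (fderiv ℝ (supp K) x - innerSL ℝ p) x :=
    hd.hasFDerivAt.sub (innerSL ℝ p).hasFDerivAt
  have h2 : IsLocalMin (fun y => supp K y - innerSL ℝ p y) x := by
    refine Eventually.of_forall fun y => ?_
    simp only [innerSL_apply_apply]
    rw [real_inner_comm, h, real_inner_comm]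
    linarith [inner_le_supp K hp y]
  have h3 := sub_eq_zero.1 (h2.hasFDerivAt_eq_zero h1)
  refine ext_inner_right ℝ fun v => ?_
  rw [gradient, InnerProductSpace.toDual_symm_apply, h3, innerSL_apply_apply]

namespace C2Plus

variable {K L : ConvexBody (E n)}

lemma gradient_mem (hK : C2Plus K) {x : E n} (hx : x ≠ 0) :
    gradient (supp K) x ∈ K ∧ inner ℝ x (gradient (supp K) x) = supp K x := by
  obtain ⟨p, hp, h⟩ := exists_inner_eq_supp K x
  rw [gradient_supp_eq (hK.hom2.differentiableAt hx) hp h]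
  exact ⟨hp, h⟩

/-- If one point `p` supports `K` in both directions, then `h_K = ⟨·, p⟩` on the segment between
them, so the gradient is constant there and the Hessian at the midpoint `m` kills `v = x' - x`.
Equal norms give `m ⟂ v`, against positive definiteness. -/
lemma gradient_injective (hK : C2Plus K) (h0 : (0 : E n) ∈ interior (K : Set (E n))) {x x' : E n}
    (hx : x ≠ 0) (hx' : x' ≠ 0) (hn : ‖x‖ = ‖x'‖)
    (h : gradient (supp K) x = gradient (supp K) x') : x = x' := by
  by_contra hne
  obtain ⟨hp, h1⟩ := hK.gradient_mem hx
  obtain ⟨-, h2⟩ := hK.gradient_mem hx'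
  rw [← h] at h2
  set p := gradient (supp K) x
  set m : E n := (1 / 2 : ℝ) • (x + x') with hm
  set v := x' - x with hv
  have hv0 : v ≠ 0 := sub_ne_zero.2 (Ne.symm hne)
  have hmv : inner ℝ m v = 0 := by
    rw [hm, hv, real_inner_smul_left, inner_sub_right, inner_add_left, inner_add_left,
      real_inner_self_eq_norm_sq, real_inner_self_eq_norm_sq, hn, real_inner_comm x x']
    ring
  -- For `x' = -x` the positive numbers `h x` and `h x'` would add up to `⟨2m, p⟩ = 0`.
  have hm0 : m ≠ 0 := by
    intro hm0
    have h3 := supp_pos h0 hx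
    have h4 := supp_pos h0 hx'
    have h5 : inner ℝ m p = 0 := by rw [hm0, inner_zero_left]
    rw [hm, real_inner_smul_left, inner_add_left, h1, h2] at h5
    linarith
  have hline : HasDerivAt (fun r : ℝ => m + r • v) v 0 := by
    simpa using ((hasDerivAt_id (0 : ℝ)).smul_const v).const_add m
  have hD : HasDerivAt (fun r : ℝ => fderiv ℝ (supp K) (m + r • v))
      (fderiv ℝ (fderiv ℝ (supp K)) m v) 0 := by
    have : HasFDerivAt (fderiv ℝ (supp K)) (fderiv ℝ (fderiv ℝ (supp K)) m) (m + (0 : ℝ) • v) := by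
      simpa using (differentiableAt_fderiv (hK.hom2.contDiffAt hm0)).hasFDerivAt
    exact this.comp_hasDerivAt (0 : ℝ) hline
  have hconst : (fun r : ℝ => fderiv ℝ (supp K) (m + r • v)) =ᶠ[𝓝 0]
      fun _ => InnerProductSpace.toDual ℝ (E n) p := by
    have e1 : ∀ᶠ r : ℝ in 𝓝 0, m + r • v ≠ 0 :=
      hline.continuousAt.eventually_ne (by simpa using hm0)
    have e2 : ∀ᶠ r : ℝ in 𝓝 0, r ∈ Ioo (-1 / 2 : ℝ) (1 / 2) :=
      Ioo_mem_nhds (by norm_num) (by norm_num)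
    filter_upwards [e1, e2] with r hr1 hr2
    have h3 : m + r • v = (1 / 2 - r) • x + (1 / 2 + r) • x' := by rw [hm, hv]; module
    have h4 : inner ℝ (m + r • v) p = supp K (m + r • v) := by
      refine le_antisymm (inner_le_supp K hp _) ?_
      rw [h3]
      refine (supp_add_le K _ _).trans_eq ?_
      rw [supp_smul K (by linarith [hr2.2]), supp_smul K (by linarith [hr2.1]), inner_add_left,
        real_inner_smul_left, real_inner_smul_left, h1, h2]
    rw [← gradient_supp_eq (hK.hom2.differentiableAt hr1) hp h4, gradient,
      LinearIsometryEquiv.apply_symm_apply]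
  have h5 := hD.unique ((hasDerivAt_const (0 : ℝ) _).congr_of_eventuallyEq hconst)
  have hmn : 0 < ‖m‖⁻¹ := inv_pos.2 (norm_pos_iff.2 hm0)
  have h6 := hK.pos (‖m‖⁻¹ • m) v (by rw [norm_smul, norm_inv, norm_norm,
    inv_mul_cancel₀ (norm_ne_zero_iff.2 hm0)]) (by rw [real_inner_smul_left, hmv, mul_zero]) hv0
  rw [hess, hK.hom2.fderiv_fderiv_smul hmn hm0, smul_apply, h5] at h6
  simp at h6

end C2Plus

/-- The parametrisation of `(K + t L) \ K` by the pairs of a unit normal and a dilation factor,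
in polar coordinates. -/
def normalMap (K L : ConvexBody (E n)) (y : E n) : E n :=
  gradient (supp K) y + ‖y‖ • gradient (supp L) y

/-! ### Normal coordinates on the shell `(K + tL) \ K` -/

section NormalMap

variable {K L : ConvexBody (E n)}

lemma normalMap_eq (hK : C2Plus K) (hL : C2Plus L) {y : E n} (hy : y ≠ 0) :
    normalMap K L y = gradient (supp (K + ‖y‖ • L)) y := by
  have h1 := hK.gradient_mem hy
  have h2 := hL.gradient_mem hy
  refine (gradient_supp_eq ((hK.add_smul hL (norm_nonneg y)).hom2.differentiableAt hy) ?_ ?_).symm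
  · refine mem_iff_forall_inner_le_supp.2 fun x => ?_
    rw [supp_add_smul_body _ _ (norm_nonneg y), normalMap, inner_add_right, real_inner_smul_right]
    exact add_le_add (inner_le_supp K h1.1 x)
      (mul_le_mul_of_nonneg_left (inner_le_supp L h2.1 x) (norm_nonneg y))
  · rw [supp_add_smul_body _ _ (norm_nonneg y), normalMap, inner_add_right, real_inner_smul_right,
      h1.2, h2.2]

lemma normalMap_mem (hK : C2Plus K) (hL : C2Plus L) {y : E n} (hy : y ≠ 0) :
    normalMap K L y ∈ K + ‖y‖ • L ∧
      inner ℝ y (normalMap K L y) = supp K y + ‖y‖ * supp L y := by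
  rw [normalMap_eq hK hL hy, ← supp_add_smul_body _ _ (norm_nonneg y)]
  exact (hK.add_smul hL (norm_nonneg y)).gradient_mem hy

/-- The common point lies in `K + ‖y‖ L` and attains the support value of `K + ‖y'‖ L` in direction
`y'`. Comparison there gives `‖y'‖ h_L(y') ≤ ‖y‖ h_L(y')`. -/
lemma norm_le_of_normalMap_eq (hK : C2Plus K) (hL : C2Plus L)
    (hL0 : (0 : E n) ∈ interior (L : Set (E n))) {y y' : E n} (hy : y ≠ 0) (hy' : y' ≠ 0)
    (h : normalMap K L y = normalMap K L y') : ‖y'‖ ≤ ‖y‖ := by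
  have h1 := (normalMap_mem hK hL hy').2
  have h2 := inner_le_supp _ (normalMap_mem hK hL hy).1 y'
  rw [h, h1, supp_add_smul_body _ _ (norm_nonneg y)] at h2
  have := supp_pos hL0 hy'
  exact le_of_mul_le_mul_right (by linarith) this

lemma injOn_normalMap (hK : C2Plus K) (hL : C2Plus L)
    (hK0 : (0 : E n) ∈ interior (K : Set (E n))) (hL0 : (0 : E n) ∈ interior (L : Set (E n))) :
    InjOn (normalMap K L) {0}ᶜ := by
  intro y hy y' hy' h
  have hn : ‖y‖ = ‖y'‖ := le_antisymm (norm_le_of_normalMap_eq hK hL hL0 hy' hy h.symm)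
    (norm_le_of_normalMap_eq hK hL hL0 hy hy' h)
  rw [normalMap_eq hK hL hy, normalMap_eq hK hL hy', ← hn] at h
  exact (hK.add_smul hL (norm_nonneg y)).gradient_injective
    (zero_mem_interior_add_smul (norm_nonneg y) hK0 (interior_subset hL0)) hy hy' hn h

/-- For surjectivity, the least `s` with `p ∈ K + sL` is the maximum over unit vectors of `(⟨x, p⟩ -
h_K) / h_L`. At a maximiser `z`, the point `p` is the support point of `K + sL` with normal `z`, so
it is the image of `s z`. -/
lemma image_normalMap (hK : C2Plus K) (hL : C2Plus L)
    (hL0 : (0 : E n) ∈ interior (L : Set (E n))) {t : ℝ} (ht : 0 ≤ t) :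
    normalMap K L '' (closedBall 0 t \ {0}) = ((K + t • L : ConvexBody (E n)) : Set (E n)) \ K := by
  ext p
  constructor
  · rintro ⟨y, ⟨hyt, hy⟩, rfl⟩
    rw [mem_closedBall_zero_iff] at hyt
    replace hy : y ≠ 0 := hy
    obtain ⟨h1, h2⟩ := normalMap_mem hK hL hy
    refine ⟨le_of_supp_le (fun x => ?_) h1, fun h3 => ?_⟩
    · rw [supp_add_smul_body _ _ (norm_nonneg y), supp_add_smul_body _ _ ht]
      have := supp_nonneg (interior_subset hL0) x
      gcongr
    · have h4 := inner_le_supp K h3 y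
      rw [h2] at h4
      have := mul_pos (norm_pos_iff.2 hy) (supp_pos hL0 hy)
      linarith
  · rintro ⟨hp, hpK⟩
    have hmem : ∃ x0 : E n, inner ℝ x0 p > supp K x0 := by
      by_contra! hcon
      exact hpK (mem_iff_forall_inner_le_supp.2 hcon)
    obtain ⟨x0, hx0⟩ := hmem
    have hx00 : x0 ≠ 0 := by rintro rfl; simp [supp_zero] at hx0
    set φ : E n → ℝ := fun x => (inner ℝ x p - supp K x) / supp L x with hφ
    have hφc : ContinuousOn φ (sphere 0 1) := by
      refine ContinuousOn.div ?_ (continuous_supp L).continuousOn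
        fun x hx => (supp_pos hL0 (ne_zero_of_mem_unit_sphere ⟨x, hx⟩)).ne'
      have := continuous_supp K
      fun_prop
    have hφs : ∀ c : ℝ, 0 < c → ∀ x, φ (c • x) = φ x := by
      intro c hc x
      simp only [hφ]
      rw [supp_smul _ hc.le, supp_smul _ hc.le, real_inner_smul_left, ← mul_sub,
        mul_div_mul_left _ _ hc.ne']
    obtain ⟨z, hz, hmax⟩ := (isCompact_sphere (0 : E n) 1).exists_isMaxOn
      ⟨_, (proj x0 hx00).2⟩ hφc
    have hz0 : z ≠ 0 := ne_zero_of_mem_unit_sphere ⟨z, hz⟩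
    have hzn : ‖z‖ = 1 := by simpa using hz
    have hle : ∀ x, x ≠ 0 → φ x ≤ φ z := fun x hx => by
      have := hmax (proj x hx).2
      rwa [mem_ofPred_eq, proj, hφs _ (inv_pos.2 (norm_pos_iff.2 hx))] at this
    set s := φ z with hs
    have hs0 : 0 < s := lt_of_lt_of_le (div_pos (by linarith) (supp_pos hL0 hx00)) (hle x0 hx00)
    have hst : s ≤ t := by
      have := inner_le_supp _ hp z
      rw [supp_add_smul_body _ _ ht] at this
      rw [hs, hφ, div_le_iff₀ (supp_pos hL0 hz0)]
      linarith
    have hzp : inner ℝ z p = supp K z + s * supp L z := by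
      have := supp_pos hL0 hz0
      rw [hs, hφ]
      field_simp
      ring
    have hnorm : ‖s • z‖ = s := by rw [norm_smul, hzn, mul_one, Real.norm_of_nonneg hs0.le]
    have hsz : s • z ≠ 0 := smul_ne_zero hs0.ne' hz0
    refine ⟨s • z, ⟨by rw [mem_closedBall_zero_iff, hnorm]; exact hst, hsz⟩, ?_⟩
    rw [normalMap_eq hK hL hsz, hnorm]
    refine gradient_supp_eq ((hK.add_smul hL hs0.le).hom2.differentiableAt hsz) ?_ ?_
    · refine mem_iff_forall_inner_le_supp.2 fun x => ?_
      rcases eq_or_ne x 0 with rfl | hx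
      · simp [supp_zero]
      have h1 := hle x hx
      rw [hφ, div_le_iff₀ (supp_pos hL0 hx)] at h1
      rw [supp_add_smul_body _ _ hs0.le]
      linarith
    · rw [supp_smul _ hs0.le, supp_add_smul_body _ _ hs0.le, real_inner_smul_left, hzp]

end NormalMap

/-! ### The volume of `K + t L` -/

/-- Measurability is asked for in polar coordinates because the Jacobian integrand of `vol_add_smul`
is explicit in that form. -/
lemma lintegral_eq_lintegral_polar (F : E n → ENNReal) (hF : Measurable fun p : S n × Ioi (0 : ℝ) =>
      F ((p.2 : ℝ) • (p.1 : E n))) (hF0 : F 0 = 0) :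
    ∫⁻ y, F y = ∫⁻ x : S n, ∫⁻ r in Ioi (0 : ℝ), ENNReal.ofReal (r ^ n) * F (r • (x : E n))
      ∂volume ∂(area n) := by
  have hmp := (volume : Measure (E n)).measurePreserving_homeomorphUnitSphereProd
  have hdim : Module.finrank ℝ (E n) - 1 = n := by simp
  rw [hdim] at hmp
  have h1 : ∫⁻ y, F y = ∫⁻ y : ({0}ᶜ : Set (E n)), F y
      ∂(volume.comap (Subtype.val : ({0}ᶜ : Set (E n)) → E n)) := by
    rw [lintegral_subtype_comap (measurableSet_singleton _).compl,
      ← lintegral_add_compl F (measurableSet_singleton (0 : E n)), lintegral_singleton, hF0,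
      zero_mul, zero_add]
  have h2 := hmp.lintegral_comp_emb (homeomorphUnitSphereProd (E n)).measurableEmbedding
    fun p => F ((p.2 : ℝ) • (p.1 : E n))
  have h3 : ∀ y : ({0}ᶜ : Set (E n)), F (((homeomorphUnitSphereProd (E n) y).2 : ℝ) •
      ((homeomorphUnitSphereProd (E n) y).1 : E n)) = F y := fun y => by
    congr 1
    exact congrArg Subtype.val ((homeomorphUnitSphereProd (E n)).symm_apply_apply y)
  simp_rw [h3] at h2
  rw [h1, h2, lintegral_prod _ hF.aemeasurable]
  refine lintegral_congr fun x => ?_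
  have h4 : Measurable fun r : Ioi (0 : ℝ) => F ((r : ℝ) • (x : E n)) :=
    hF.comp measurable_prodMk_left
  rw [Measure.volumeIoiPow, lintegral_withDensity_eq_lintegral_mul _ (by fun_prop) h4]
  exact lintegral_subtype_comap measurableSet_Ioi fun r : ℝ =>
    ENNReal.ofReal (r ^ n) * F (r • (x : E n))

section Derivative

variable {K L : ConvexBody (E n)}

/-- The Riesz isomorphism as a real linear map. -/
def rieszCLM (n : ℕ) : (E n →L[ℝ] ℝ) →L[ℝ] E n where
  toFun := (InnerProductSpace.toDual ℝ (E n)).symm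
  map_add' := map_add _
  map_smul' c f := by simp
  cont := (InnerProductSpace.toDual ℝ (E n)).symm.continuous

/-- The derivative of the gradient. -/
def hessCLM (f : E n → ℝ) (y : E n) : E n →L[ℝ] E n :=
  (rieszCLM n).comp (fderiv ℝ (fderiv ℝ f) y)

lemma inner_hessCLM (f : E n → ℝ) (y v w : E n) :
    inner ℝ (hessCLM f y v) w = fderiv ℝ (fderiv ℝ f) y v w := by
  exact InnerProductSpace.toDual_symm_apply

lemma hasFDerivAt_gradient {f : E n → ℝ} {y : E n} (hf : ContDiffAt ℝ 2 f y) :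
    HasFDerivAt (gradient f) (hessCLM f y) y :=
  (rieszCLM n).hasFDerivAt.comp y (differentiableAt_fderiv hf).hasFDerivAt

/-- The derivative of `normalMap`. -/
def normalDeriv (K L : ConvexBody (E n)) (y : E n) : E n →L[ℝ] E n :=
  hessCLM (supp K) y + (‖y‖ • hessCLM (supp L) y
    + (fderiv ℝ (fun y : E n => ‖y‖) y).smulRight (gradient (supp L) y))

lemma hasFDerivAt_normalMap (hK : C2Plus K) (hL : C2Plus L) {y : E n} (hy : y ≠ 0) :
    HasFDerivAt (normalMap K L) (normalDeriv K L y) y :=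
  (hasFDerivAt_gradient (hK.hom2.contDiffAt hy)).add
    ((hom2_norm.differentiableAt hy).hasFDerivAt.smul
      (hasFDerivAt_gradient (hL.hom2.contDiffAt hy)))

lemma apply_eq_inner_single (v : E n) (i : Fin (n + 1)) :
    v i = inner ℝ v (EuclideanSpace.single i (1 : ℝ)) := by
  simp [EuclideanSpace.inner_single_right]

/-- Hessians of 1-homogeneous functions scale by `s⁻¹`, and differentiating the factor `‖y‖` adds
the rank-one matrix `∇h_L ⊗ x`. Its contribution to the determinant is `⟨x, ∇h_L⟩ = h_L(x)`. -/
lemma det_normalDeriv (hK : C2Plus K) (hL : C2Plus L) (x : S n) {s : ℝ} (hs : 0 < s) :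
    (normalDeriv K L (s • (x : E n))).det = s⁻¹ ^ n * (supp L x *
      (bodyMatrix K x + s • hessMat (supp L) x).det) := by
  have hx := ne_zero_of_sphere x
  have h1 : LinearMap.toMatrix (EuclideanSpace.basisFun (Fin (n + 1)) ℝ).toBasis
      (EuclideanSpace.basisFun (Fin (n + 1)) ℝ).toBasis
      ((normalDeriv K L (s • (x : E n)) : E n →L[ℝ] E n) : E n →ₗ[ℝ] E n)
      = s⁻¹ • (hessMat (supp K) x + s • hessMat (supp L) x)
        + Matrix.vecMulVec (gradient (supp L) (x : E n) : E n).ofLp (x : E n).ofLp := by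
    ext i j
    have hg : gradient (supp L) (s • (x : E n)) = gradient (supp L) x := by
      rw [gradient, gradient, hL.hom2.fderiv_smul hs]
    have hn : ‖s • (x : E n)‖ = s := by
      rw [norm_smul, norm_sphere, mul_one, Real.norm_of_nonneg hs.le]
    have hj : inner ℝ (x : E n) (EuclideanSpace.single j (1 : ℝ)) = (x : E n) j := by
      simp [EuclideanSpace.inner_single_right]
    rw [LinearMap.toMatrix_apply]
    simp only [OrthonormalBasis.coe_toBasis, EuclideanSpace.basisFun_apply,
      OrthonormalBasis.coe_toBasis_repr_apply, EuclideanSpace.basisFun_repr,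
      ContinuousLinearMap.coe_coe]
    rw [apply_eq_inner_single, normalDeriv]
    simp only [add_apply, smul_apply, inner_add_left, real_inner_smul_left, inner_hessCLM,
      ContinuousLinearMap.smulRight_apply]
    rw [hK.hom2.fderiv_fderiv_smul hs hx, hL.hom2.fderiv_fderiv_smul hs hx, hg, hn,
      hom2_norm.fderiv_smul hs, fderiv_norm_apply hx, hj, ← apply_eq_inner_single]
    simp only [smul_apply, Matrix.add_apply, Matrix.smul_apply, hessMat, Matrix.of_apply,
      Matrix.vecMulVec_apply, smul_eq_mul, norm_sphere]
    rw [fderiv_fderiv_symm (hK.hom2.contDiffAt hx), fderiv_fderiv_symm (hL.hom2.contDiffAt hx)]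
    ring
  have h2 : ((x : E n) : Fin (n + 1) → ℝ) ᵥ* (hessMat (supp K) x + s • hessMat (supp L) x) = 0 := by
    rw [Matrix.vecMul_add, Matrix.vecMul_smul, vecMul_hessMat hK.hom2, vecMul_hessMat hL.hom2]
    simp
  rw [ContinuousLinearMap.det, ← LinearMap.det_toMatrix
    (EuclideanSpace.basisFun (Fin (n + 1)) ℝ).toBasis, h1,
    det_inv_smul_add_vecMulVec h2 (dotProduct_self_sphere x) hs.ne', ← inner_eq_dotProduct,
    (hL.gradient_mem hx).2, bodyMatrix_eq, add_right_comm]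
  ring

end Derivative

instance : CompactSpace (S n) := isCompact_iff_compactSpace.1 (isCompact_sphere _ _)

instance : IsFiniteMeasure (area n) := inferInstanceAs (IsFiniteMeasure (Measure.toSphere _))

lemma _root_.Continuous.integrable_sphere {ν : Measure (S n)} [IsFiniteMeasure ν] {f : S n → ℝ}
    (hf : Continuous f) : Integrable f ν :=
  hf.integrable_of_hasCompactSupport (HasCompactSupport.of_compactSpace f)

section Volume

variable {K L : ConvexBody (E n)}

/-- The density of the volume of `K + t L` in the coordinates given by `normalMap`. -/
def growth (K L : ConvexBody (E n)) (x : S n) (s : ℝ) : ℝ :=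
  supp L x * (bodyMatrix K x + s • hessMat (supp L) x).det

lemma continuous_bodyMatrix (hK : C2Plus K) : Continuous fun x : S n => bodyMatrix K x := by
  simp_rw [bodyMatrix_eq]
  refine (continuous_hessMat hK.hom2).add ?_
  fun_prop

lemma continuous_growth (hK : C2Plus K) (hL : C2Plus L) :
    Continuous fun p : S n × ℝ => growth K L p.1 p.2 := by
  have h1 := (continuous_bodyMatrix hK).comp (continuous_fst (X := S n) (Y := ℝ))
  have h2 := (continuous_hessMat hL.hom2).comp (continuous_fst (X := S n) (Y := ℝ))
  have h3 := (continuous_supp L).comp (continuous_subtype_val.comp (continuous_fst (X := S n) (Y := ℝ)))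
  exact h3.mul (h1.add (continuous_snd.smul h2)).matrix_det

lemma growth_nonneg (hK : C2Plus K) (hL : C2Plus L) (hL0 : (0 : E n) ∈ interior (L : Set (E n)))
    (x : S n) {s : ℝ} (hs : 0 ≤ s) : 0 ≤ growth K L x s := by
  rw [growth, ← hK.bodyMatrix_add_smul hL hs]
  exact mul_nonneg (supp_pos hL0 (ne_zero_of_sphere x)).le ((hK.add_smul hL hs).detH_pos x).le

/-- Change of variables by the injective map `normalMap`, then polar coordinates: the weight `r^n`
cancels the factor `r^{-n}` of the Jacobian. -/
lemma vol_add_smul (hK : C2Plus K) (hL : C2Plus L)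
    (hK0 : (0 : E n) ∈ interior (K : Set (E n))) (hL0 : (0 : E n) ∈ interior (L : Set (E n)))
    {t : ℝ} (ht : 0 ≤ t) :
    vol (K + t • L) = vol K + ∫ x, (∫ s in (0 : ℝ)..t, growth K L x s) ∂(area n) := by
  have hgc := continuous_growth hK hL
  have hcont : Continuous fun x : S n => ∫ s in (0 : ℝ)..t, growth K L x s :=
    intervalIntegral.continuous_parametric_intervalIntegral_of_continuous' hgc 0 t
  have hnn : ∀ x : S n, 0 ≤ ∫ s in (0 : ℝ)..t, growth K L x s := fun x =>
    intervalIntegral.integral_nonneg ht fun s hs => growth_nonneg hK hL hL0 x hs.1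
  have hD : MeasurableSet (closedBall (0 : E n) t \ {0}) :=
    measurableSet_closedBall.diff (measurableSet_singleton _)
  have h1 := lintegral_abs_det_fderiv_eq_addHaar_image volume hD
    (fun y hy => (hasFDerivAt_normalMap hK hL hy.2).hasFDerivWithinAt)
    ((injOn_normalMap hK hL hK0 hL0).mono fun y hy => hy.2)
  rw [image_normalMap hK hL hL0 ht, ← lintegral_indicator hD] at h1
  have key : ∀ (x : S n) (r : ℝ), 0 < r → (closedBall (0 : E n) t \ {0}).indicator
      (fun y => ENNReal.ofReal |(normalDeriv K L y).det|) (r • (x : E n))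
      = (Iic t).indicator (fun r => ENNReal.ofReal (r⁻¹ ^ n * growth K L x r)) r := by
    intro x r hr
    have hmem : r • (x : E n) ∈ closedBall (0 : E n) t \ {0} ↔ r ∈ Iic t := by
      simp [norm_smul, abs_of_pos hr, hr.ne', ne_zero_of_sphere x]
    by_cases hrt : r ∈ Iic t
    · rw [indicator_of_mem hrt, indicator_of_mem (hmem.2 hrt), det_normalDeriv hK hL x hr,
        abs_of_nonneg]
      · rfl
      · exact mul_nonneg (by positivity) (growth_nonneg hK hL hL0 x hr.le)
    · rw [indicator_of_notMem hrt, indicator_of_notMem (mt hmem.1 hrt)]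
  rw [lintegral_eq_lintegral_polar _ ?_ (by simp)] at h1
  · have h2 : ∀ x : S n, ∫⁻ r in Ioi (0 : ℝ), ENNReal.ofReal (r ^ n) *
        (closedBall (0 : E n) t \ {0}).indicator
          (fun y => ENNReal.ofReal |(normalDeriv K L y).det|) (r • (x : E n))
        = ENNReal.ofReal (∫ s in (0 : ℝ)..t, growth K L x s) := by
      intro x
      have e1 : ∀ r ∈ Ioi (0 : ℝ), ENNReal.ofReal (r ^ n) *
          (closedBall (0 : E n) t \ {0}).indicator
            (fun y => ENNReal.ofReal |(normalDeriv K L y).det|) (r • (x : E n))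
          = (Iic t).indicator (fun r => ENNReal.ofReal (growth K L x r)) r := by
        intro r hr
        rw [key x r hr]
        by_cases hrt : r ∈ Iic t
        · rw [indicator_of_mem hrt, indicator_of_mem hrt,
            ← ENNReal.ofReal_mul (pow_nonneg (le_of_lt hr) n), ← mul_assoc, ← mul_pow,
            mul_inv_cancel₀ (ne_of_gt hr), one_pow, one_mul]
        · rw [indicator_of_notMem hrt, indicator_of_notMem hrt, mul_zero]
      have hc : Continuous fun r => growth K L x r := hgc.comp (Continuous.prodMk_right x)
      rw [setLIntegral_congr_fun measurableSet_Ioi e1, lintegral_indicator measurableSet_Iic,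
        Measure.restrict_restrict measurableSet_Iic, Iic_inter_Ioi,
        intervalIntegral.integral_of_le ht, ofReal_integral_eq_lintegral_ofReal
          (hc.integrableOn_Icc.mono_set Ioc_subset_Icc_self)]
      filter_upwards [ae_restrict_mem measurableSet_Ioc] with s hs
      exact growth_nonneg hK hL hL0 x hs.1.le
    rw [lintegral_congr h2, ← ofReal_integral_eq_lintegral_ofReal hcont.integrable_sphere
      (Eventually.of_forall hnn)] at h1
    have hsub := subset_add_smul (K := K) ht (interior_subset hL0)
    rw [vol, vol, ← measureReal_sdiff_add_inter K.isClosed.measurableSet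
        (ConvexBody.isCompact _).measure_ne_top, inter_eq_right.2 hsub,
      measureReal_def, ← h1, ENNReal.toReal_ofReal (integral_nonneg hnn), add_comm]
  · have : (fun p : S n × Ioi (0 : ℝ) => (closedBall (0 : E n) t \ {0}).indicator
        (fun y => ENNReal.ofReal |(normalDeriv K L y).det|) ((p.2 : ℝ) • (p.1 : E n)))
        = {p : S n × Ioi (0 : ℝ) | (p.2 : ℝ) ≤ t}.indicator
          fun p => ENNReal.ofReal ((p.2 : ℝ)⁻¹ ^ n * growth K L p.1 p.2) := by
      ext p
      rw [key p.1 p.2 p.2.2]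
      rfl
    rw [this]
    refine Measurable.indicator ?_ (measurableSet_le (by fun_prop) measurable_const)
    have h3 : Measurable fun p : S n × Ioi (0 : ℝ) => growth K L p.1 p.2 :=
      (hgc.comp (f := fun p : S n × Ioi (0 : ℝ) => (p.1, (p.2 : ℝ))) (by fun_prop)).measurable
    exact ENNReal.measurable_ofReal.comp
      (((measurable_subtype_coe.comp measurable_snd).inv.pow_const n).mul h3)

end Volume

/-! ### Bodies with a prescribed support function -/

/-- A convex function lies above its tangent at `x`, and by Euler's identity this tangent is the
linear map `Df(x)`. Convexity is used through two applications of the mean value theorem along the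
segment from `x` to `y`. -/
lemma fderiv_le_of_hessian_nonneg {f : E n → ℝ} (hf : Hom2 f)
    (h2 : ∀ z v : E n, z ≠ 0 → 0 ≤ fderiv ℝ (fderiv ℝ f) z v v) (h0 : ∀ y, 0 ≤ f y) {x : E n}
    (hx : x ≠ 0) (y : E n) : fderiv ℝ f x y ≤ f y := by
  -- A segment through the origin leaves the domain of smoothness. Then `y` is a nonpositive
  -- multiple of `x`, so `Df(x) y ≤ 0 ≤ f y`.
  by_cases hseg : ∃ r ∈ Icc (0 : ℝ) 1, x + r • (y - x) = 0
  · obtain ⟨r, hr, h⟩ := hseg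
    have hr0 : r ≠ 0 := by rintro rfl; simp at h; exact hx h
    have hy : r • y = -((1 - r) • x) := by
      rw [← add_eq_zero_iff_eq_neg, ← h]; module
    have h1 : r * fderiv ℝ f x y = -((1 - r) * f x) := by
      have := congrArg (fderiv ℝ f x) hy
      simpa [hf.fderiv_self hx] using this
    have h3 : r * fderiv ℝ f x y ≤ 0 := by
      rw [h1]
      exact neg_nonpos.2 (mul_nonneg (by linarith [hr.2]) (h0 x))
    exact (nonpos_of_mul_nonpos_right h3 (lt_of_le_of_ne hr.1 hr0.symm)).trans (h0 y)
  · push Not at hseg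
    set v := y - x with hv
    have hl : ∀ r : ℝ, HasDerivAt (fun r : ℝ => x + r • v) v r := fun r => by
      simpa using ((hasDerivAt_id r).smul_const v).const_add x
    have hg : ∀ r ∈ Icc (0 : ℝ) 1, HasDerivAt (fun r : ℝ => f (x + r • v))
        (fderiv ℝ f (x + r • v) v) r := fun r hr =>
      (hf.differentiableAt (hseg r hr)).hasFDerivAt.comp_hasDerivAt r (hl r)
    have hg' : ∀ r ∈ Icc (0 : ℝ) 1, HasDerivAt (fun r : ℝ => fderiv ℝ f (x + r • v) v)
        (fderiv ℝ (fderiv ℝ f) (x + r • v) v v) r := fun r hr => by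
      have h3 := (differentiableAt_fderiv
        (hf.contDiffAt (hseg r hr))).hasFDerivAt.comp_hasDerivAt r (hl r)
      simpa using h3.clm_apply (hasDerivAt_const r v)
    obtain ⟨ξ, hξ, h3⟩ := exists_hasDerivAt_eq_slope (fun r : ℝ => f (x + r • v))
      (fun r => fderiv ℝ f (x + r • v) v) zero_lt_one
      (fun r hr => (hg r hr).continuousAt.continuousWithinAt)
      (fun r hr => hg r (Ioo_subset_Icc_self hr))
    obtain ⟨η, hη, h4⟩ := exists_hasDerivAt_eq_slope (fun r : ℝ => fderiv ℝ f (x + r • v) v)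
      (fun r => fderiv ℝ (fderiv ℝ f) (x + r • v) v v) hξ.1
      (fun r hr => (hg' r ⟨hr.1, hr.2.trans hξ.2.le⟩).continuousAt.continuousWithinAt)
      (fun r hr => hg' r ⟨hr.1.le, (hr.2.trans hξ.2).le⟩)
    have h5 := h2 (x + η • v) v (hseg η ⟨hη.1.le, (hη.2.trans hξ.2).le⟩)
    rw [h4, le_div_iff₀ (by linarith [hξ.1])] at h5
    simp only [sub_zero, div_one, one_smul, zero_smul, add_zero] at h3 h5
    have h6 : x + v = y := by rw [hv]; abel
    rw [h6] at h3
    have h7 : fderiv ℝ f x v = fderiv ℝ f x y - f x := by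
      rw [hv, map_sub, hf.fderiv_self hx]
    linarith

/-- The body is `{p | ⟨y, p⟩ ≤ f y for all y}`; the gradient of `f` at `x` belongs to it and attains
the value `f x`. -/
lemma exists_body_of_hessian_nonneg {f : E n → ℝ} (hf : Hom2 f)
    (h2 : ∀ z v : E n, z ≠ 0 → 0 ≤ fderiv ℝ (fderiv ℝ f) z v v) (h0 : ∀ y, 0 ≤ f y) :
    ∃ L : ConvexBody (E n), supp L = f := by
  obtain ⟨M, hM⟩ := (isCompact_sphere (0 : E n) 1).exists_bound_of_continuousOn
    (hf.contDiffOn.continuousOn.mono fun x hx => ne_zero_of_sphere ⟨x, hx⟩)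
  have hfM : ∀ y, f y ≤ M * ‖y‖ := fun y => by
    rcases eq_or_ne y 0 with rfl | hy
    · simp [hf.map_zero]
    have h3 := (le_abs_self _).trans (hM _ (proj y hy).2)
    have hn := norm_pos_iff.2 hy
    rw [proj, hf.hom _ (inv_pos.2 hn)] at h3
    field_simp at h3
    linarith
  let L : ConvexBody (E n) :=
    { carrier := {p | ∀ y, inner ℝ y p ≤ f y}
      convex' := fun p hp q hq a b ha hb hab y => by
        rw [inner_add_right, real_inner_smul_right, real_inner_smul_right]
        calc a * inner ℝ y p + b * inner ℝ y q ≤ a * f y + b * f y :=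
              add_le_add (mul_le_mul_of_nonneg_left (hp y) ha) (mul_le_mul_of_nonneg_left (hq y) hb)
          _ = f y := by rw [← add_mul, hab, one_mul]
      isCompact' := by
        refine Metric.isCompact_of_isClosed_isBounded ?_ ?_
        · rw [ofPred_forall]
          exact isClosed_iInter fun y => isClosed_le (by fun_prop) continuous_const
        · refine isBounded_iff_forall_norm_le.2 ⟨max M 0, fun p hp => ?_⟩
          have h3 := (hp p).trans (hfM p)
          rw [real_inner_self_eq_norm_sq, sq] at h3
          rcases eq_or_ne p 0 with rfl | hp0
          · simp
          exact (le_of_mul_le_mul_right h3 (norm_pos_iff.2 hp0)).trans (le_max_left _ _)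
      nonempty' := ⟨0, fun y => by rw [inner_zero_right]; exact h0 y⟩ }
  refine ⟨L, funext fun x => ?_⟩
  rcases eq_or_ne x 0 with rfl | hx
  · rw [supp_zero, hf.map_zero]
  refine le_antisymm (supp_le fun y hy => hy x) ?_
  have h3 : gradient f x ∈ L := fun y => by
    rw [real_inner_comm, gradient, InnerProductSpace.toDual_symm_apply]
    exact fderiv_le_of_hessian_nonneg hf h2 h0 hx y
  have h4 := inner_le_supp L h3 x
  rwa [real_inner_comm, gradient, InnerProductSpace.toDual_symm_apply, hf.fderiv_self hx] at h4

lemma exists_hessian_lower_bound {f : E n → ℝ} (hf : Hom2 f) :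
    ∃ C : ℝ, ∀ x v : E n, ‖x‖ = 1 → -(C * ‖v‖ ^ 2) ≤ fderiv ℝ (fderiv ℝ f) x v v := by
  have h : ContinuousOn (fun x : E n => fderiv ℝ (fderiv ℝ f) x) (sphere 0 1) := fun x hx =>
    (continuousAt_fderiv_fderiv (hf.contDiffAt (ne_zero_of_sphere ⟨x, hx⟩))).continuousWithinAt
  obtain ⟨C, hC⟩ := IsCompact.exists_bound_of_continuousOn (E := E n →L[ℝ] E n →L[ℝ] ℝ)
    (isCompact_sphere (0 : E n) 1) h
  refine ⟨C, fun x v hx => ?_⟩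
  have h1 := (fderiv ℝ (fderiv ℝ f) x).le_opNorm₂ v v
  have h2 := hC x (by simpa using hx)
  have h3 : ‖fderiv ℝ (fderiv ℝ f) x‖ * ‖v‖ * ‖v‖ ≤ C * ‖v‖ ^ 2 := by
    rw [mul_assoc, ← sq]
    exact mul_le_mul_of_nonneg_right h2 (sq_nonneg _)
  linarith [neg_abs_le (fderiv ℝ (fderiv ℝ f) x v v),
    Real.norm_eq_abs (fderiv ℝ (fderiv ℝ f) x v v)]

/-- Adding a large multiple of the norm makes the tangential Hessian positive. On the sphere this
exhibits `φ` as `h_L - C`, so integrals against `φ` reduce to those against support functions. -/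
lemma exists_body {φ : S n → ℝ} (hφ : SphereC2 φ) : ∃ (C : ℝ) (L : ConvexBody (E n)),
    C2Plus L ∧ (0 : E n) ∈ interior (L : Set (E n)) ∧ supp L = fun y => ext1 φ y + C * ‖y‖ := by
  obtain ⟨C0, hC0⟩ := exists_hessian_lower_bound hφ.hom2_ext1
  obtain ⟨C1, hC1⟩ := isCompact_univ.exists_bound_of_continuousOn hφ.continuous.continuousOn
  -- `|C0|` absorbs the Hessian of `ext1 φ`, `|C1|` its values on the sphere, and `1` leaves the
  -- margins `‖v‖²` and `‖y‖`.
  set C := |C0| + |C1| + 1 with hC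
  set f : E n → ℝ := fun y => ext1 φ y + C * ‖y‖ with hf
  have hf2 : Hom2 f := hφ.hom2_ext1.add (hom2_norm.const_mul C)
  have hpos : ∀ x v : E n, ‖x‖ = 1 → inner ℝ x v = 0 →
      ‖v‖ ^ 2 ≤ fderiv ℝ (fderiv ℝ f) x v v := by
    intro x v hx hv
    have hx0 : x ≠ 0 := by rintro rfl; simp at hx
    rw [hf, fderiv_fderiv_add (hφ.hom2_ext1.contDiffAt hx0)
      ((hom2_norm.const_mul C).contDiffAt hx0), fderiv_fderiv_const_mul C (hom2_norm.contDiffAt hx0)]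
    simp only [add_apply, smul_apply, smul_eq_mul]
    rw [fderiv_fderiv_norm_apply hx, hv, real_inner_self_eq_norm_sq]
    have h1 := hC0 x v hx
    have h2 := mul_le_mul_of_nonneg_right (le_abs_self C0) (sq_nonneg ‖v‖)
    have h3 := mul_nonneg (abs_nonneg C1) (sq_nonneg ‖v‖)
    rw [hC]
    linarith
  have hnonneg : ∀ z v : E n, z ≠ 0 → 0 ≤ fderiv ℝ (fderiv ℝ f) z v v := by
    intro z v hz
    have hn := norm_pos_iff.2 hz
    set x := ‖z‖⁻¹ • z with hx
    have hzx : z = ‖z‖ • x := by rw [hx, smul_smul, mul_inv_cancel₀ hn.ne', one_smul]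
    have hx1 : ‖x‖ = 1 := by rw [hx, norm_smul, norm_inv, norm_norm, inv_mul_cancel₀ hn.ne']
    have hx0 : x ≠ 0 := by intro h; rw [h] at hx1; simp at hx1
    have h3 : inner ℝ x (v - inner ℝ x v • x) = 0 := by
      rw [inner_sub_right, real_inner_smul_right, real_inner_self_eq_norm_sq, hx1]; ring
    have h4 := (sq_nonneg _).trans (hpos x _ hx1 h3)
    rw [hzx, hf2.fderiv_fderiv_smul hn hx0]
    simp only [map_sub, map_smul, sub_apply, smul_apply, smul_eq_mul,
      hf2.fderiv_fderiv_self_left hx0, hf2.fderiv_fderiv_self_right hx0, mul_zero, sub_zero] at h4 ⊢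
    exact mul_nonneg (inv_nonneg.2 hn.le) h4
  have hnorm : ∀ y, ‖y‖ ≤ f y := by
    intro y
    rcases eq_or_ne y 0 with rfl | hy
    · simp [hf2.map_zero]
    have h1 := hC1 (proj y hy) (mem_univ _)
    rw [Real.norm_eq_abs] at h1
    have h2 : -|C1| ≤ ext0 φ y := by
      rw [ext0_of_ne φ hy]
      linarith [neg_abs_le (φ (proj y hy)), le_abs_self C1]
    have h3 := mul_le_mul_of_nonneg_right h2 (norm_nonneg y)
    have h4 := mul_nonneg (abs_nonneg C0) (norm_nonneg y)
    simp only [hf, ext1, hC]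
    linarith
  obtain ⟨L, hL⟩ := exists_body_of_hessian_nonneg hf2 hnonneg
    fun y => (norm_nonneg y).trans (hnorm y)
  refine ⟨C, L, ⟨hL ▸ hf2.contDiffOn, fun x v hx hv hv0 => ?_⟩, ?_, hL⟩
  · rw [hess, hL]
    exact lt_of_lt_of_le (by positivity) (hpos x v hx hv)
  · refine mem_interior.2 ⟨ball 0 1, fun p hp => ?_, isOpen_ball, by simp⟩
    refine mem_iff_forall_inner_le_supp.2 fun y => ?_
    rw [mem_ball_zero_iff] at hp
    rw [hL]
    have := mul_le_mul_of_nonneg_left hp.le (norm_nonneg y)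
    linarith [real_inner_le_norm y p, hnorm y]

/-! ### Mixed volumes as combinations of volumes -/

/-- The first mixed volume of `K` and `L`, up to a constant, as a combination of volumes. -/
def mixedVol (L K : ConvexBody (E n)) : ℝ :=
  ∑ j ∈ Finset.range (n + 3), (exists_eval_zero_weights (n + 1)).choose j *
    (vol (K + (j : ℝ) • L) - vol K)

/-- The second mixed volume of `K`, `L` and `M`, up to a constant. -/
def mixedVol₂ (L M K : ConvexBody (E n)) : ℝ :=
  ∑ j ∈ Finset.range (n + 2), (exists_coeff_one_weights (n + 1)).choose j *
    mixedVol L (K + (j : ℝ) • M)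

/-- The polarisation `U^{ij} f_{ij}` of the determinant. -/
def cofDensity (f : E n → ℝ) (K : ConvexBody (E n)) (x : S n) : ℝ :=
  ((bodyMatrix K x).adjugate * hessMat f x).trace

section MixedVolumes

variable {K L M : ConvexBody (E n)}

lemma continuousAt_mixedVol (hK0 : (0 : E n) ∈ interior (K : Set (E n)))
    (hL0 : (0 : E n) ∈ interior (L : Set (E n))) : ContinuousAt (mixedVol L) K :=
  tendsto_finsetSum _ fun j _ => tendsto_const_nhds.mul
    ((continuousAt_vol_add_smul (Nat.cast_nonneg j) hK0 (interior_subset hL0)).sub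
      (continuousAt_vol hK0))

lemma continuousAt_mixedVol₂ (hK0 : (0 : E n) ∈ interior (K : Set (E n)))
    (hL0 : (0 : E n) ∈ interior (L : Set (E n))) (hM0 : (0 : E n) ∈ interior (M : Set (E n))) :
    ContinuousAt (mixedVol₂ L M) K := by
  refine tendsto_finsetSum _ fun j _ => tendsto_const_nhds.mul ?_
  exact ContinuousAt.comp (f := fun K : ConvexBody (E n) => K + (j : ℝ) • M)
    (continuousAt_mixedVol
      (zero_mem_interior_add_smul (Nat.cast_nonneg j) hK0 (interior_subset hM0)) hL0)
    (continuous_add_body _).continuousAt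

lemma continuous_detH (hK : C2Plus K) : Continuous (detH K) :=
  (continuous_bodyMatrix hK).matrix_det

lemma continuous_cofDensity {f : E n → ℝ} (hf : Hom2 f) (hK : C2Plus K) :
    Continuous (cofDensity f K) :=
  ((continuous_bodyMatrix hK).matrix_adjugate.matrix_mul (continuous_hessMat hf)).matrix_trace

lemma continuous_supp_sphere (K : ConvexBody (E n)) : Continuous fun x : S n => supp K (x : E n) :=
  (continuous_supp K).comp continuous_subtype_val

/-- The integrand is `growth` at `s = 0`, a polynomial in `s` of degree at most `n + 1`; its
integrals over `[0, j]` for `j ≤ n + 2` determine it, and over the sphere they become volume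
differences. -/
lemma integral_supp_mul_detH (hK : C2Plus K) (hL : C2Plus L)
    (hK0 : (0 : E n) ∈ interior (K : Set (E n))) (hL0 : (0 : E n) ∈ interior (L : Set (E n))) :
    ∫ x, supp L x * detH K x ∂(area n) = mixedVol L K := by
  set c := (exists_eval_zero_weights (n + 1)).choose
  have hc := (exists_eval_zero_weights (n + 1)).choose_spec
  have hgc := continuous_growth hK hL
  have h1 : ∀ x : S n, supp L x * detH K x
      = ∑ j ∈ Finset.range (n + 3), c j * ∫ s in (0 : ℝ)..j, growth K L x s := by
    intro x
    obtain ⟨p, hp, hps⟩ := exists_det_polynomial (bodyMatrix K x) (hessMat (supp L) x)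
    have h2 := hc (Polynomial.C (supp L x) * p) ((Polynomial.natDegree_C_mul_le _ _).trans hp)
    simp only [Polynomial.eval_mul, Polynomial.eval_C, hps, zero_smul, add_zero] at h2
    exact h2
  have h2 : ∀ j ∈ Finset.range (n + 3), Integrable
      (fun x : S n => c j * ∫ s in (0 : ℝ)..j, growth K L x s) (area n) := fun j _ =>
    (continuous_const.mul (intervalIntegral.continuous_parametric_intervalIntegral_of_continuous'
      hgc 0 j)).integrable_sphere
  simp_rw [h1]
  rw [integral_finsetSum _ h2]
  refine Finset.sum_congr rfl fun j _ => ?_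
  rw [integral_const_mul, vol_add_smul hK hL hK0 hL0 (Nat.cast_nonneg j), add_sub_cancel_left]

/-- Pointwise, `cofDensity` is the linear coefficient of `s ↦ det (bodyMatrix K + s D²h_M)`, whose
value at `s = j` is `detH` of `K + jM`. -/
lemma integral_supp_mul_cofDensity (hK : C2Plus K) (hL : C2Plus L) (hM : C2Plus M)
    (hK0 : (0 : E n) ∈ interior (K : Set (E n))) (hL0 : (0 : E n) ∈ interior (L : Set (E n)))
    (hM0 : (0 : E n) ∈ interior (M : Set (E n))) :
    ∫ x, supp L x * cofDensity (supp M) K x ∂(area n) = mixedVol₂ L M K := by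
  set c := (exists_coeff_one_weights (n + 1)).choose
  have hc := (exists_coeff_one_weights (n + 1)).choose_spec
  have hj : ∀ j : ℕ, C2Plus (K + (j : ℝ) • M) := fun j => hK.add_smul hM (Nat.cast_nonneg j)
  have h1 : ∀ x : S n, supp L x * cofDensity (supp M) K x
      = ∑ j ∈ Finset.range (n + 2), c j * (supp L x * detH (K + (j : ℝ) • M) x) := by
    intro x
    obtain ⟨p, hp, hps⟩ := exists_det_polynomial (bodyMatrix K x) (hessMat (supp M) x)
    rw [cofDensity, ← coeff_one_of_eval_eq_det (hK.detH_pos x).ne' hps, hc p hp, Finset.mul_sum]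
    refine Finset.sum_congr rfl fun j _ => ?_
    rw [hps, detH, hK.bodyMatrix_add_smul hM (Nat.cast_nonneg j)]
    ring
  have h2 : ∀ j ∈ Finset.range (n + 2), Integrable
      (fun x : S n => c j * (supp L x * detH (K + (j : ℝ) • M) x)) (area n) := fun j _ =>
    (continuous_const.mul
      ((continuous_supp_sphere L).mul (continuous_detH (hj j)))).integrable_sphere
  simp_rw [h1]
  rw [integral_finsetSum _ h2]
  refine Finset.sum_congr rfl fun j _ => ?_
  rw [integral_const_mul, integral_supp_mul_detH (hj j) hL
    (zero_mem_interior_add_smul (Nat.cast_nonneg j) hK0 (interior_subset hM0)) hL0]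

end MixedVolumes

/-- Functionals of smooth bodies that extend continuously to all bodies around the origin. -/
def ExtendsContinuously (F : ConvexBody (E n) → ℝ) : Prop :=
  ∃ G : ConvexBody (E n) → ℝ,
    (∀ K : ConvexBody (E n), (0 : E n) ∈ interior (K : Set (E n)) → ContinuousAt G K) ∧
    ∀ K : ConvexBody (E n), C2Plus K → (0 : E n) ∈ interior (K : Set (E n)) → F K = G K

/-! ### Continuous extension of the integrals from smooth bodies -/

namespace ExtendsContinuously

variable {F F' : ConvexBody (E n) → ℝ}

lemma add (h : ExtendsContinuously F) (h' : ExtendsContinuously F') :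
    ExtendsContinuously fun K => F K + F' K := by
  obtain ⟨G, h1, h2⟩ := h
  obtain ⟨G', h1', h2'⟩ := h'
  exact ⟨fun K => G K + G' K, fun K hK => (h1 K hK).add (h1' K hK), fun K hK hK0 =>
    congrArg₂ (· + ·) (h2 K hK hK0) (h2' K hK hK0)⟩

lemma const_mul (c : ℝ) (h : ExtendsContinuously F) : ExtendsContinuously fun K => c * F K := by
  obtain ⟨G, h1, h2⟩ := h
  exact ⟨fun K => c * G K, fun K hK => (h1 K hK).const_mul c, fun K hK hK0 =>
    congrArg (c * ·) (h2 K hK hK0)⟩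

lemma congr (h : ExtendsContinuously F) (h' : ∀ K, C2Plus K → F' K = F K) :
    ExtendsContinuously F' := by
  obtain ⟨G, h1, h2⟩ := h
  exact ⟨G, h1, fun K hK hK0 => by rw [h' K hK, h2 K hK hK0]⟩

end ExtendsContinuously

lemma cofDensity_add_const_mul {f : E n → ℝ} (hf : Hom2 f) (C : ℝ) (K : ConvexBody (E n))
    (x : S n) : cofDensity (fun y => f y + C * ‖y‖) K x
      = cofDensity f K x + C * cofDensity (fun y => ‖y‖) K x := by
  have hx := ne_zero_of_sphere x
  rw [cofDensity, hessMat_add (hf.contDiffAt hx) ((hom2_norm.const_mul C).contDiffAt hx),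
    hessMat_const_mul C (hom2_norm.contDiffAt hx), mul_add, Matrix.trace_add, mul_smul_comm,
    Matrix.trace_smul, smul_eq_mul, cofDensity, cofDensity]

/-- The unit ball. -/
def unitBall (n : ℕ) : ConvexBody (E n) :=
  ⟨closedBall 0 1, convex_closedBall _ _, isCompact_closedBall _ _, ⟨0, by simp⟩⟩

lemma supp_unitBall : supp (unitBall n) = fun y => ‖y‖ := by
  ext y
  refine le_antisymm (supp_le fun z hz => ?_) ?_
  · replace hz : ‖z‖ ≤ 1 := by simpa [unitBall] using (show z ∈ closedBall (0 : E n) 1 from hz)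
    have := mul_le_mul_of_nonneg_left hz (norm_nonneg y)
    linarith [real_inner_le_norm y z]
  · have := mul_norm_le_supp (K := unitBall n) zero_le_one subset_rfl y
    linarith

lemma zero_mem_interior_unitBall : (0 : E n) ∈ interior (unitBall n : Set (E n)) :=
  mem_interior.2 ⟨ball 0 1, ball_subset_closedBall, isOpen_ball, by simp⟩

lemma c2Plus_unitBall : C2Plus (unitBall n) := by
  refine ⟨supp_unitBall ▸ hom2_norm.contDiffOn, fun x v hx hv hv0 => ?_⟩
  rw [hess, supp_unitBall, fderiv_fderiv_norm_apply hx, hv, real_inner_self_eq_norm_sq]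
  have := norm_pos_iff.2 hv0
  simp only [mul_zero, sub_zero]
  positivity

/-- On the sphere `φ = h_L - C h_B` with `B` the unit ball, and the functional is linear in `φ`. -/
lemma extendsContinuously_integral_mul {φ : S n → ℝ} (hφ : SphereC2 φ)
    {ρ : ConvexBody (E n) → S n → ℝ} (hρ : ∀ K, C2Plus K → Continuous (ρ K))
    (h : ∀ L : ConvexBody (E n), C2Plus L → (0 : E n) ∈ interior (L : Set (E n)) →
      ExtendsContinuously fun K => ∫ x, supp L x * ρ K x ∂(area n)) :
    ExtendsContinuously fun K => ∫ x, φ x * ρ K x ∂(area n) := by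
  obtain ⟨C, L, hL, hL0, hs⟩ := exists_body hφ
  refine ((h L hL hL0).add ((h _ c2Plus_unitBall zero_mem_interior_unitBall).const_mul (-C))).congr
    fun K hK => ?_
  have h1 : Integrable (fun x : S n => supp L x * ρ K x) (area n) :=
    ((continuous_supp_sphere L).mul (hρ K hK)).integrable_sphere
  have h2 : Integrable (fun x : S n => -C * (supp (unitBall n) x * ρ K x)) (area n) :=
    (continuous_const.mul ((continuous_supp_sphere _).mul (hρ K hK))).integrable_sphere
  rw [← integral_const_mul, ← integral_add h1 h2]
  refine integral_congr_ae (Eventually.of_forall fun x => ?_)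
  simp only [hs, supp_unitBall, ext1_sphere, norm_sphere]
  ring

lemma extendsContinuously_detH {φ : S n → ℝ} (hφ : SphereC2 φ) :
    ExtendsContinuously fun K => ∫ x, φ x * detH K x ∂(area n) :=
  extendsContinuously_integral_mul hφ (fun _ hK => continuous_detH hK) fun L hL hL0 =>
    ⟨mixedVol L, fun _ hK => continuousAt_mixedVol hK hL0,
      fun _ hK hK0 => integral_supp_mul_detH hK hL hK0 hL0⟩

lemma extendsContinuously_cofDensity_supp {φ : S n → ℝ} (hφ : SphereC2 φ) {M : ConvexBody (E n)}
    (hM : C2Plus M) (hM0 : (0 : E n) ∈ interior (M : Set (E n))) :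
    ExtendsContinuously fun K => ∫ x, φ x * cofDensity (supp M) K x ∂(area n) :=
  extendsContinuously_integral_mul hφ (fun _ hK => continuous_cofDensity hM.hom2 hK)
    fun L hL hL0 => ⟨mixedVol₂ L M, fun _ hK => continuousAt_mixedVol₂ hK hL0 hM0,
      fun _ hK hK0 => integral_supp_mul_cofDensity hK hL hM hK0 hL0 hM0⟩

lemma extendsContinuously_cofDensity_norm {φ : S n → ℝ} (hφ : SphereC2 φ) :
    ExtendsContinuously fun K => ∫ x, φ x * cofDensity (fun y => ‖y‖) K x ∂(area n) :=
  supp_unitBall (n := n) ▸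
    extendsContinuously_cofDensity_supp hφ c2Plus_unitBall zero_mem_interior_unitBall

/-- The same decomposition, now in the second slot, in which `cofDensity` is linear. -/
lemma extendsContinuously_cofDensity_ext1 {φ ψ : S n → ℝ} (hφ : SphereC2 φ) (hψ : SphereC2 ψ) :
    ExtendsContinuously fun K => ∫ x, φ x * cofDensity (ext1 ψ) K x ∂(area n) := by
  obtain ⟨C, M, hM, hM0, hs⟩ := exists_body hψ
  refine ((extendsContinuously_cofDensity_supp hφ hM hM0).add
    ((extendsContinuously_cofDensity_norm hφ).const_mul (-C))).congr fun K hK => ?_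
  have h1 : Integrable (fun x : S n => φ x * cofDensity (supp M) K x) (area n) :=
    (hφ.continuous.mul (continuous_cofDensity hM.hom2 hK)).integrable_sphere
  have h2 : Integrable (fun x : S n => -C * (φ x * cofDensity (fun y => ‖y‖) K x)) (area n) :=
    (continuous_const.mul
      (hφ.continuous.mul (continuous_cofDensity hom2_norm hK))).integrable_sphere
  rw [← integral_const_mul, ← integral_add h1 h2]
  refine integral_congr_ae (Eventually.of_forall fun x => ?_)
  simp only [hs, cofDensity_add_const_mul hψ.hom2_ext1]
  ring

/-! ### Weak limits of measures on the sphere -/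

lemma abs_integral_sub_integral_le (ν : Measure (S n)) [IsFiniteMeasure ν] (φ ψ : C(S n, ℝ)) :
    |∫ x, φ x ∂ν - ∫ x, ψ x ∂ν| ≤ ν.real univ * dist φ ψ := by
  rw [← integral_sub φ.continuous.integrable_sphere ψ.continuous.integrable_sphere, mul_comm,
    ← Real.norm_eq_abs]
  refine norm_integral_le_of_norm_le_const (Eventually.of_forall fun x => ?_)
  rw [← dist_eq_norm]
  exact ContinuousMap.dist_apply_le_dist x

lemma continuous_integral (ν : Measure (S n)) [IsFiniteMeasure ν] :
    Continuous fun φ : C(S n, ℝ) => ∫ x, φ x ∂ν :=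
  (LipschitzWith.of_dist_le' (K := ν.real univ)
    fun φ ψ => abs_integral_sub_integral_le ν φ ψ).continuous

/-- Stone–Weierstrass: the coordinate functions separate points. -/
lemma dense_sphereC2 : Dense {φ : C(S n, ℝ) | SphereC2 φ} := by
  let A : Subalgebra ℝ C(S n, ℝ) :=
    { carrier := {φ | SphereC2 φ}
      mul_mem' := fun hφ hψ => SphereC2.mul hφ hψ
      add_mem' := fun hφ hψ => SphereC2.add hφ hψ
      algebraMap_mem' := fun c => SphereC2.const c }
  have h := ContinuousMap.subalgebra_topologicalClosure_eq_top_of_separatesPoints A fun x y hxy => by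
    obtain ⟨i, hi⟩ : ∃ i, (x : E n) i ≠ (y : E n) i := by
      by_contra! hcon
      exact hxy (Subtype.ext (PiLp.ext hcon))
    exact ⟨_, ⟨⟨fun z : S n => (z : E n) i, (SphereC2.coord i).continuous⟩, SphereC2.coord i, rfl⟩,
      hi⟩
  have h2 : closure (A : Set C(S n, ℝ)) = univ := by
    rw [← Subalgebra.topologicalClosure_coe, h]; rfl
  exact dense_iff_closure_eq.2 h2

/-- Testing with `1` bounds the masses eventually; by density the integrals of every continuous
function are then Cauchy. Their limit is a positive functional, represented by Riesz–Markov. -/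
lemma exists_weakConv {ι : Type*} {l : Filter ι} [NeBot l] {ν : ι → Measure (S n)}
    (hν : ∀ᶠ k in l, IsFiniteMeasure (ν k))
    (h : ∀ φ : S n → ℝ, SphereC2 φ → ∃ a, Tendsto (fun k => ∫ x, φ x ∂(ν k)) l (𝓝 a)) :
    ∃ μ : Measure (S n), IsFiniteMeasure μ ∧ WeakConv ν l μ := by
  obtain ⟨m, hm⟩ := h _ (SphereC2.const 1)
  have hmass : ∀ᶠ k in l, (ν k).real univ ≤ |m| + 1 := by
    have h1 : m < |m| + 1 := by linarith [le_abs_self m]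
    filter_upwards [hm.eventually (gt_mem_nhds h1)] with k hk
    simpa using hk.le
  have hlim : ∀ φ : C(S n, ℝ), ∃ a, Tendsto (fun k => ∫ x, φ x ∂(ν k)) l (𝓝 a) := by
    intro φ
    refine cauchy_map_iff_exists_tendsto.1 (Metric.cauchy_iff.2 ⟨inferInstance, fun ε hε => ?_⟩)
    have hM : 0 < |m| + 1 := by positivity
    obtain ⟨ψ, hψ, hd⟩ := Metric.mem_closure_iff.1 (dense_sphereC2 φ) (ε / 4 / (|m| + 1))
      (by positivity)
    obtain ⟨a, ha⟩ := h ψ hψ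
    have h1 : ∀ᶠ k in l, dist (∫ x, φ x ∂(ν k)) a < ε / 2 := by
      filter_upwards [hν, hmass, Metric.tendsto_nhds.1 ha (ε / 4) (by positivity)] with k h1 h2 h3
      have h4 := abs_integral_sub_integral_le (ν k) φ ψ
      have h5 : (ν k).real univ * dist φ ψ ≤ (|m| + 1) * (ε / 4 / (|m| + 1)) :=
        mul_le_mul h2 hd.le dist_nonneg hM.le
      rw [mul_div_cancel₀ _ hM.ne'] at h5
      rw [← Real.dist_eq] at h4
      linarith [dist_triangle (∫ x, φ x ∂(ν k)) (∫ x, ψ x ∂(ν k)) a]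
    refine ⟨ball a (ε / 2), mem_map.2 h1, fun x hx y hy => ?_⟩
    rw [mem_ball] at hx hy
    linarith [dist_triangle_right x y a]
  choose Λ hΛ using hlim
  let Λ' : CompactlySupportedContinuousMap (S n) ℝ →ₚ[ℝ] ℝ := PositiveLinearMap.mk₀
    { toFun := fun φ => Λ φ
      map_add' := fun φ ψ => by
        refine tendsto_nhds_unique (hΛ _) (((hΛ φ).add (hΛ ψ)).congr' ?_)
        filter_upwards [hν] with k hk
        exact (integral_add φ.continuous.integrable_sphere ψ.continuous.integrable_sphere).symm
      map_smul' := fun c φ => by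
        refine tendsto_nhds_unique (hΛ _) (((hΛ φ).const_mul c).congr fun k => ?_)
        exact (integral_const_mul c _).symm }
    fun φ hφ => ge_of_tendsto' (hΛ _) fun k => integral_nonneg fun x => hφ x
  refine ⟨RealRMK.rieszMeasure Λ', inferInstance, fun φ => ?_⟩
  have h2 := RealRMK.integral_rieszMeasure Λ' ⟨φ, HasCompactSupport.of_compactSpace _⟩
  have h3 : ∫ x, φ x ∂(RealRMK.rieszMeasure Λ') = Λ φ := h2
  rw [h3]
  exact hΛ φ

lemma weakConv_of_sphereC2 {ι : Type*} {l : Filter ι} [NeBot l] {ν : ι → Measure (S n)}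
    (hν : ∀ᶠ k in l, IsFiniteMeasure (ν k)) {μ : Measure (S n)} [IsFiniteMeasure μ]
    (h : ∀ φ : S n → ℝ, SphereC2 φ → Tendsto (fun k => ∫ x, φ x ∂(ν k)) l (𝓝 (∫ x, φ x ∂μ))) :
    WeakConv ν l μ := by
  obtain ⟨μ', hμ', hw⟩ := exists_weakConv hν fun φ hφ => ⟨_, h φ hφ⟩
  have h1 := (continuous_integral μ').ext_on dense_sphereC2 (continuous_integral μ)
    fun φ hφ => tendsto_nhds_unique (hw φ) (h φ hφ)
  intro φ
  rw [← congrFun h1 φ]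
  exact hw φ

/-! ### Measures given by densities -/

/-- Densities on the sphere, attached to smooth bodies, whose integrals against `C²` functions
extend continuously to all bodies. -/
structure StableDensity (ρ : ConvexBody (E n) → S n → ℝ) : Prop where
  continuous : ∀ K, C2Plus K → Continuous (ρ K)
  nonneg : ∀ K, C2Plus K → ∀ x, 0 ≤ ρ K x
  extends_continuously : ∀ φ : S n → ℝ, SphereC2 φ →
    ExtendsContinuously fun K => ∫ x, φ x * ρ K x ∂(area n)

lemma bodyMeasure_eq {ρ : ConvexBody (E n) → S n → ℝ} {K : ConvexBody (E n)}
    (hK : IsEvenC2Plus K) :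
    bodyMeasure ρ K = (area n).withDensity fun x => ENNReal.ofReal (ρ K x) := if_pos hK

namespace StableDensity

variable {ρ : ConvexBody (E n) → S n → ℝ}

lemma integral_withDensity (hρ : StableDensity ρ) {K : ConvexBody (E n)} (hK : C2Plus K) (φ : S n → ℝ) :
    ∫ x, φ x ∂((area n).withDensity fun x => ENNReal.ofReal (ρ K x))
      = ∫ x, φ x * ρ K x ∂(area n) := by
  have hm : Measurable fun x => ENNReal.ofReal (ρ K x) :=
    ENNReal.measurable_ofReal.comp (hρ.continuous K hK).measurable
  rw [integral_withDensity_eq_integral_toReal_smul hm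
    (Eventually.of_forall fun _ => ENNReal.ofReal_lt_top)]
  refine integral_congr_ae (Eventually.of_forall fun x => ?_)
  simp only [ENNReal.toReal_ofReal (hρ.nonneg K hK x), smul_eq_mul, mul_comm]

lemma isFiniteMeasure_withDensity (hρ : StableDensity ρ) {K : ConvexBody (E n)} (hK : C2Plus K) :
    IsFiniteMeasure ((area n).withDensity fun x => ENNReal.ofReal (ρ K x)) :=
  isFiniteMeasure_withDensity_ofReal (hρ.continuous K hK).integrable_sphere.2

/-- The last clause records that for smooth `K` the limit agrees with the integral given by the
density, which reconciles the two branches of `bodyMeasure`. -/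
lemma tendsto_integral (hρ : StableDensity ρ) {K : ConvexBody (E n)} (hK : IsEvenBody K) {φ : S n → ℝ}
    (hφ : SphereC2 φ) : ∃ a, Tendsto (fun K' => ∫ x, φ x
      ∂((area n).withDensity fun x => ENNReal.ofReal (ρ K' x))) (𝓝[{K' | IsEvenC2Plus K'}] K) (𝓝 a)
      ∧ (C2Plus K → a = ∫ x, φ x ∂((area n).withDensity fun x => ENNReal.ofReal (ρ K x))) := by
  obtain ⟨G, h1, h2⟩ := hρ.extends_continuously φ hφ
  refine ⟨G K, ((h1 K hK.zero_mem_interior).mono_left nhdsWithin_le_nhds).congr' ?_, fun hK2 => ?_⟩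
  · filter_upwards [self_mem_nhdsWithin] with K' hK'
    rw [hρ.integral_withDensity (IsEvenC2Plus.c2Plus hK')]
    exact (h2 K' (IsEvenC2Plus.c2Plus hK') (IsEvenBody.zero_mem_interior hK'.1)).symm
  · rw [hρ.integral_withDensity hK2]
    exact (h2 K hK2 hK.zero_mem_interior).symm

lemma weakConv_nhdsWithin (hρ : StableDensity ρ) {K : ConvexBody (E n)} (hK : IsEvenBody K)
    [NeBot (𝓝[{K' | IsEvenC2Plus K'}] K)] : IsFiniteMeasure (bodyMeasure ρ K) ∧
      WeakConv (fun K' => (area n).withDensity fun x => ENNReal.ofReal (ρ K' x))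
        (𝓝[{K' | IsEvenC2Plus K'}] K) (bodyMeasure ρ K) := by
  have hfin : ∀ᶠ K' in 𝓝[{K' | IsEvenC2Plus K'}] K,
      IsFiniteMeasure ((area n).withDensity fun x => ENNReal.ofReal (ρ K' x)) := by
    filter_upwards [self_mem_nhdsWithin] with K' hK'
    exact hρ.isFiniteMeasure_withDensity (IsEvenC2Plus.c2Plus hK')
  by_cases hK2 : IsEvenC2Plus K
  · have := hρ.isFiniteMeasure_withDensity hK2.c2Plus
    rw [bodyMeasure, if_pos hK2]
    refine ⟨this, weakConv_of_sphereC2 hfin fun φ hφ => ?_⟩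
    obtain ⟨a, ha, ha'⟩ := hρ.tendsto_integral hK hφ
    exact ha' hK2.c2Plus ▸ ha
  · have h := exists_weakConv hfin fun φ hφ => (hρ.tendsto_integral hK hφ).imp fun a ha => ha.1
    rw [bodyMeasure, if_neg hK2, dif_pos h]
    exact h.choose_spec

lemma isFiniteMeasure (hρ : StableDensity ρ) {K : ConvexBody (E n)} (hK : IsEvenC2Plus K) :
    IsFiniteMeasure (bodyMeasure ρ K) :=
  bodyMeasure_eq hK ▸ hρ.isFiniteMeasure_withDensity hK.c2Plus

/-- The given sequence itself shows that the filter of smooth even bodies near `K` is nontrivial, so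
no separate approximation theorem is needed. -/
lemma weakConv (hρ : StableDensity ρ) {K : ConvexBody (E n)} {Kk : ℕ → ConvexBody (E n)} (hK : IsEvenBody K)
    (hKk : ∀ k, IsEvenC2Plus (Kk k)) (hlim : Tendsto Kk atTop (𝓝 K)) :
    IsFiniteMeasure (bodyMeasure ρ K) ∧
      WeakConv (fun k => bodyMeasure ρ (Kk k)) atTop (bodyMeasure ρ K) := by
  have ht : Tendsto Kk atTop (𝓝[{K' | IsEvenC2Plus K'}] K) :=
    tendsto_nhdsWithin_iff.2 ⟨hlim, Eventually.of_forall hKk⟩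
  have := ht.neBot
  obtain ⟨h1, h2⟩ := hρ.weakConv_nhdsWithin hK
  refine ⟨h1, fun φ => ?_⟩
  simp_rw [fun k => bodyMeasure_eq (ρ := ρ) (hKk k)]
  exact (h2 φ).comp ht

end StableDensity

/-! ### The three densities -/

lemma trace_mul_vecMulVec (A : Matrix (Fin (n + 1)) (Fin (n + 1)) ℝ) (v : Fin (n + 1) → ℝ) :
    (A * Matrix.vecMulVec v v).trace = ∑ i, ∑ j, A i j * v i * v j := by
  simp only [Matrix.trace, Matrix.diag_apply, Matrix.mul_apply, Matrix.vecMulVec_apply]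
  exact Finset.sum_congr rfl fun i _ => Finset.sum_congr rfl fun j _ => by ring

lemma hessMat_norm (x : S n) :
    hessMat (fun y : E n => ‖y‖) x = 1 - Matrix.vecMulVec (x : E n).ofLp (x : E n).ofLp := by
  ext i j
  rw [hessMat, Matrix.of_apply, fderiv_fderiv_norm_apply (norm_sphere x)]
  simp [EuclideanSpace.inner_single_right, Matrix.vecMulVec_apply, Matrix.one_apply,
    eq_comm]

/-- The Hessian of the norm is `1 - x xᵀ`, so pairing it with the adjugate removes exactly the entry
in direction `x`. -/
lemma traceDensity_eq (K : ConvexBody (E n)) :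
    traceDensity K = cofDensity (fun y => ‖y‖) K := by
  ext x
  rw [traceDensity, cofactorForm, cofDensity, hessMat_norm, mul_sub, mul_one, Matrix.trace_sub,
    trace_mul_vecMulVec]

lemma vecMulVec_sphereGrad {u : S n → ℝ} (hu : SphereC2 u) (x : S n) :
    Matrix.vecMulVec (sphereGrad u x).ofLp (sphereGrad u x).ofLp
      = (1 / 2 : ℝ) • hessMat (ext1 fun x => u x * u x) x - u x • hessMat (ext1 u) x
        + ((1 / 2) * u x ^ 2) • hessMat (fun y : E n => ‖y‖) x := by
  ext i j
  have h : ∀ i, (sphereGrad u x).ofLp i = fderiv ℝ (ext0 u) x (EuclideanSpace.single i 1) := by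
    intro i
    rw [apply_eq_inner_single, sphereGrad, gradient, InnerProductSpace.toDual_symm_apply]
  rw [Matrix.vecMulVec_apply, h, h, fderiv_ext0_mul_fderiv_ext0 hu]
  simp [hessMat]

/-- A density quadratic in `∇u` becomes a combination of densities `cofDensity`, for which
continuity is available; the factors `u` and `u²` can later be absorbed into the test function. -/
lemma gradDensity_eq {u : S n → ℝ} (hu : SphereC2 u) (K : ConvexBody (E n)) (x : S n) :
    gradDensity u K x = (1 / 2) * cofDensity (ext1 fun x => u x * u x) K x
      - u x * cofDensity (ext1 u) K x + (1 / 2) * u x ^ 2 * cofDensity (fun y => ‖y‖) K x := by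
  rw [gradDensity, cofactorForm, ← trace_mul_vecMulVec, vecMulVec_sphereGrad hu, mul_add, mul_sub,
    Matrix.trace_add, Matrix.trace_sub]
  simp only [mul_smul_comm, Matrix.trace_smul, smul_eq_mul, cofDensity]

lemma C2Plus.posSemidef_adjugate {K : ConvexBody (E n)} (hK : C2Plus K) (x : S n) :
    (bodyMatrix K x).adjugate.PosSemidef := by
  have h := hK.posDef_bodyMatrix x
  have h1 : (bodyMatrix K x).adjugate = (bodyMatrix K x).det • (bodyMatrix K x)⁻¹ := by
    rw [Matrix.inv_def, Ring.inverse_eq_inv', smul_smul, mul_inv_cancel₀ h.det_pos.ne', one_smul]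
  rw [h1]
  exact h.inv.posSemidef.smul h.det_pos.le

lemma gradDensity_nonneg {K : ConvexBody (E n)} (hK : C2Plus K) (u : S n → ℝ) (x : S n) :
    0 ≤ gradDensity u K x := by
  have h := (hK.posSemidef_adjugate x).dotProduct_mulVec_nonneg (sphereGrad u x).ofLp
  refine h.trans_eq ?_
  simp only [gradDensity, cofactorForm, dotProduct, Matrix.mulVec, Pi.star_apply, star_trivial,
    Finset.mul_sum]
  exact Finset.sum_congr rfl fun i _ => Finset.sum_congr rfl fun j _ => by ring

/-- With the orthogonal projection `P = 1 - x xᵀ`, the density is the trace of `Pᴴ U P`, where `U`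
is the positive semidefinite adjugate. -/
lemma traceDensity_nonneg {K : ConvexBody (E n)} (hK : C2Plus K) (x : S n) :
    0 ≤ traceDensity K x := by
  set P : Matrix (Fin (n + 1)) (Fin (n + 1)) ℝ :=
    1 - Matrix.vecMulVec (x : E n).ofLp (x : E n).ofLp with hP
  have h1 : P * Pᴴ = P := by
    have h2 : Pᴴ = P := by
      ext i j
      simp [hP, Matrix.vecMulVec_apply, Matrix.one_apply, eq_comm, mul_comm]
    rw [h2, hP, sub_mul, mul_sub, mul_sub, Matrix.vecMulVec_mul_vecMulVec, dotProduct_self_sphere]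
    simp
  have h3 := ((hK.posSemidef_adjugate x).conjTranspose_mul_mul_same P).trace_nonneg
  rwa [Matrix.mul_assoc, Matrix.trace_mul_comm, Matrix.mul_assoc, h1, hP, ← hessMat_norm,
    ← cofDensity, ← traceDensity_eq] at h3

lemma stableDensity_detH : StableDensity (detH (n := n)) :=
  ⟨fun _ hK => continuous_detH hK, fun _ hK x => (hK.detH_pos x).le,
    fun _ hφ => extendsContinuously_detH hφ⟩

lemma stableDensity_traceDensity : StableDensity (traceDensity (n := n)) := by
  refine ⟨fun K hK => ?_, fun _ hK => traceDensity_nonneg hK, fun φ hφ => ?_⟩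
  · rw [traceDensity_eq]
    exact continuous_cofDensity hom2_norm hK
  · simp_rw [traceDensity_eq]
    exact extendsContinuously_cofDensity_norm hφ

lemma stableDensity_gradDensity {u : S n → ℝ} (hu : SphereC2 u) :
    StableDensity (gradDensity u) := by
  have hc1 := fun (K : ConvexBody (E n)) (hK : C2Plus K) =>
    continuous_cofDensity (hu.mul hu).hom2_ext1 hK
  have hc2 := fun (K : ConvexBody (E n)) (hK : C2Plus K) => continuous_cofDensity hu.hom2_ext1 hK
  have hc3 := fun (K : ConvexBody (E n)) (hK : C2Plus K) => continuous_cofDensity hom2_norm hK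
  have huc := hu.continuous
  refine ⟨fun K hK => ?_, fun _ hK => gradDensity_nonneg hK u, fun φ hφ => ?_⟩
  · simp_rw [funext fun x => gradDensity_eq hu K x]
    have := hc1 K hK
    have := hc2 K hK
    have := hc3 K hK
    fun_prop
  · refine (((extendsContinuously_cofDensity_ext1 hφ (hu.mul hu)).const_mul (1 / 2)).add
      (((extendsContinuously_cofDensity_ext1 (hφ.mul hu) hu).const_mul (-1)).add
      ((extendsContinuously_cofDensity_norm (hφ.mul (hu.mul hu))).const_mul (1 / 2)))).congr
      fun K hK => ?_
    have h1 := hc1 K hK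
    have h2 := hc2 K hK
    have h3 := hc3 K hK
    have hφc := hφ.continuous
    have i1 : Integrable (fun x => 1 / 2 * (φ x * cofDensity (ext1 fun x => u x * u x) K x))
      (area n) := Continuous.integrable_sphere (by fun_prop)
    have i2 : Integrable (fun x => -1 * (φ x * u x * cofDensity (ext1 u) K x))
      (area n) := Continuous.integrable_sphere (by fun_prop)
    have i3 : Integrable (fun x => 1 / 2 * (φ x * (u x * u x) * cofDensity (fun y => ‖y‖) K x))
      (area n) := Continuous.integrable_sphere (by fun_prop)
    simp_rw [← integral_const_mul]
    rw [← integral_add i2 i3]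
    refine Eq.trans (integral_congr_ae (Eventually.of_forall fun x => ?_))
      (integral_add i1 (i2.add i3))
    simp only [gradDensity_eq hu]
    ring

/-! ### Convergence of the Rayleigh quotients -/

/-- Testing with `1` shows that the masses converge, so uniformly small changes of the integrand do
not matter. -/
lemma tendsto_integral_of_tendsto {ν : ℕ → Measure (S n)} (hν : ∀ k, IsFiniteMeasure (ν k))
    {μ : Measure (S n)} (h : WeakConv ν atTop μ) {φk : ℕ → C(S n, ℝ)} {φ : C(S n, ℝ)}
    (hφ : Tendsto φk atTop (𝓝 φ)) :
    Tendsto (fun k => ∫ x, φk k x ∂(ν k)) atTop (𝓝 (∫ x, φ x ∂μ)) := by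
  have h1 : Tendsto (fun k => (ν k).real univ * dist (φk k) φ) atTop (𝓝 0) := by
    have h2 := (h 1).mul (tendsto_iff_dist_tendsto_zero.1 hφ)
    simpa using h2
  have h3 : Tendsto (fun k => ∫ x, φk k x ∂(ν k) - ∫ x, φ x ∂(ν k)) atTop (𝓝 0) :=
    squeeze_zero_norm (fun k => abs_integral_sub_integral_le (ν k) (φk k) φ) h1
  simpa using h3.add (h φ)

/-- The restriction of the support function to the sphere. -/
def suppC (K : ConvexBody (E n)) : C(S n, ℝ) := ⟨fun x => supp K x, continuous_supp_sphere K⟩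

lemma continuous_suppC : Continuous (suppC (n := n)) := by
  refine (LipschitzWith.of_dist_le_mul (K := 1) fun K L => ?_).continuous
  rw [NNReal.coe_one, one_mul, ContinuousMap.dist_le dist_nonneg]
  intro x
  have := abs_supp_sub_supp_le K L x
  rwa [norm_sphere, mul_one] at this

lemma IsEvenBody.supp_ne_zero {K : ConvexBody (E n)} (hK : IsEvenBody K) (x : S n) :
    supp K x ≠ 0 := (supp_pos hK.zero_mem_interior (ne_zero_of_sphere x)).ne'

lemma IsEvenBody.isUnit_suppC {K : ConvexBody (E n)} (hK : IsEvenBody K) : IsUnit (suppC K) :=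
  (ContinuousMap.isUnit_iff_forall_ne_zero _).2 hK.supp_ne_zero

/-- Viewing `1/h` as an inverse in the Banach algebra `C(S n, ℝ)` yields its uniform convergence
from continuity of inversion at units. -/
lemma IsEvenBody.inverse_suppC_apply {K : ConvexBody (E n)} (hK : IsEvenBody K) (x : S n) :
    Ring.inverse (suppC K) x = (supp K x)⁻¹ := by
  have h := DFunLike.congr_fun (Ring.mul_inverse_cancel _ hK.isUnit_suppC) x
  exact eq_inv_of_mul_eq_one_right h

lemma add_smul_self (K : ConvexBody (E n)) {c : ℝ} (hc : 0 ≤ c) : K + c • K = (1 + c) • K := by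
  have h : ∀ x, supp (K + c • K) x = supp ((1 + c) • K) x := fun x => by
    rw [supp_add_smul_body _ _ hc, supp_smul_body _ (by positivity)]
    ring
  exact ConvexBody.ext ((le_of_supp_le fun x => (h x).le).antisymm
    (le_of_supp_le fun x => (h x).ge))

lemma mixedVol_self (K : ConvexBody (E n)) : mixedVol K K = (n + 1) * vol K := by
  -- The weights are applied to the derivative of `(X + 1)^(n+1)`: its integral over `[0, j]` is `(1
  -- + j)^(n+1) - 1`, matching `vol (K + jK) - vol K`, and its value at `0` is `n + 1`.
  have hc := (exists_eval_zero_weights (n + 1)).choose_spec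
    (((Polynomial.X : Polynomial ℝ) + Polynomial.C 1) ^ (n + 1)).derivative
    ((Polynomial.natDegree_derivative_le _).trans (by
      rw [Polynomial.natDegree_pow, Polynomial.natDegree_X_add_C]; omega))
  have h1 : ∀ t : ℝ, ∫ s in (0 : ℝ)..t,
      (((Polynomial.X : Polynomial ℝ) + Polynomial.C 1) ^ (n + 1)).derivative.eval s
      = (1 + t) ^ (n + 1) - 1 := by
    intro t
    rw [intervalIntegral.integral_eq_sub_of_hasDerivAt (fun s _ => Polynomial.hasDerivAt _ s)
      ((Polynomial.continuous _).intervalIntegrable _ _)]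
    simp [add_comm]
  simp_rw [h1] at hc
  have h2 : ∀ j : ℕ, vol (K + (j : ℝ) • K) - vol K = ((1 + (j : ℝ)) ^ (n + 1) - 1) * vol K := by
    intro j
    rw [add_smul_self K (Nat.cast_nonneg j), vol_smul (by positivity)]
    ring
  simp_rw [mixedVol, h2, ← mul_assoc]
  rw [← Finset.sum_mul, ← hc, Polynomial.derivative_X_add_C_pow]
  simp

section Limits

variable {K : ConvexBody (E n)} {Kk : ℕ → ConvexBody (E n)}

/-- The identity `∫ h dS_K = (n + 1) vol K` holds for the smooth `K_k` and passes to the limit.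
Positivity makes the normalising inverses converge. -/
lemma integral_supp_surfMeasure_pos (hK : IsEvenBody K) (hKk : ∀ k, IsEvenC2Plus (Kk k))
    (hlim : Tendsto Kk atTop (𝓝 K)) : 0 < ∫ x, supp K x ∂(surfMeasure K) := by
  have h := tendsto_integral_of_tendsto (fun k => stableDensity_detH.isFiniteMeasure (hKk k))
    (stableDensity_detH.weakConv hK hKk hlim).2 ((continuous_suppC.tendsto K).comp hlim)
  have h1 : ∀ k, ∫ x, suppC (Kk k) x ∂(bodyMeasure detH (Kk k)) = (n + 1) * vol (Kk k) := by
    intro k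
    have h2 := (hKk k).c2Plus
    have h3 := IsEvenBody.zero_mem_interior (hKk k).1
    rw [bodyMeasure_eq (hKk k), stableDensity_detH.integral_withDensity h2, ← mixedVol_self,
      ← integral_supp_mul_detH h2 h2 h3 h3]
    rfl
  have h4 := ((continuousAt_vol hK.zero_mem_interior).tendsto.comp hlim).const_mul ((n : ℝ) + 1)
  have h5 := tendsto_nhds_unique (h.congr h1) h4
  have h6 : ∫ x, supp K x ∂(surfMeasure K) = (n + 1) * vol K := h5
  rw [h6]
  have := vol_pos hK.1
  positivity

lemma tendsto_integral_bodyMeasure {ρ : ConvexBody (E n) → S n → ℝ} (hρ : StableDensity ρ)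
    (hK : IsEvenBody K) (hKk : ∀ k, IsEvenC2Plus (Kk k)) (hlim : Tendsto Kk atTop (𝓝 K))
    {φk : ℕ → C(S n, ℝ)} {φ : C(S n, ℝ)} (hφ : Tendsto φk atTop (𝓝 φ)) {fk : ℕ → S n → ℝ}
    {f : S n → ℝ} (hfk : ∀ k x, fk k x = φk k x) (hf : ∀ x, f x = φ x) :
    Tendsto (fun k => ∫ x, fk k x ∂(bodyMeasure ρ (Kk k))) atTop
      (𝓝 (∫ x, f x ∂(bodyMeasure ρ K))) := by
  simp_rw [hfk, hf]
  exact tendsto_integral_of_tendsto (fun k => hρ.isFiniteMeasure (hKk k))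
    (hρ.weakConv hK hKk hlim).2 hφ

lemma tendsto_integral_supp (hK : IsEvenBody K) (hKk : ∀ k, IsEvenC2Plus (Kk k))
    (hlim : Tendsto Kk atTop (𝓝 K)) :
    Tendsto (fun k => ∫ x, supp (Kk k) x ∂(surfMeasure (Kk k))) atTop
      (𝓝 (∫ x, supp K x ∂(surfMeasure K))) :=
  tendsto_integral_bodyMeasure stableDensity_detH hK hKk hlim
    ((continuous_suppC.tendsto K).comp hlim) (fun _ _ => rfl) fun _ => rfl

lemma tendsto_energy {u : S n → ℝ} (hu : SphereC2 u) (hK : IsEvenBody K)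
    (hKk : ∀ k, IsEvenC2Plus (Kk k)) (hlim : Tendsto Kk atTop (𝓝 K)) :
    Tendsto (fun k => energy (Kk k) u) atTop (𝓝 (energy K u)) :=
  tendsto_integral_bodyMeasure (stableDensity_gradDensity hu) hK hKk hlim
    (((continuous_suppC.tendsto K).comp hlim).pow 2) (fun _ _ => rfl) fun _ => rfl

lemma tendsto_mean {u : S n → ℝ} (hu : SphereC2 u) (hK : IsEvenBody K)
    (hKk : ∀ k, IsEvenC2Plus (Kk k)) (hlim : Tendsto Kk atTop (𝓝 K)) :
    Tendsto (fun k => mean (Kk k) u) atTop (𝓝 (mean K u)) :=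
  ((tendsto_integral_supp hK hKk hlim).inv₀ (integral_supp_surfMeasure_pos hK hKk hlim).ne').mul
    (tendsto_integral_bodyMeasure stableDensity_detH hK hKk hlim
      (((continuous_suppC.tendsto K).comp hlim).const_mul ⟨u, hu.continuous⟩)
      (fun _ _ => rfl) fun _ => rfl)

lemma tendsto_spread {u : S n → ℝ} (hu : SphereC2 u) (hK : IsEvenBody K)
    (hKk : ∀ k, IsEvenC2Plus (Kk k)) (hlim : Tendsto Kk atTop (𝓝 K)) :
    Tendsto (fun k => spread (Kk k) u) atTop (𝓝 (spread K u)) := by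
  -- The means vary with `k`; as constant functions they converge uniformly.
  have h1 : Tendsto (fun k => algebraMap ℝ C(S n, ℝ) (mean (Kk k) u)) atTop
      (𝓝 (algebraMap ℝ C(S n, ℝ) (mean K u))) :=
    ((continuous_algebraMap ℝ C(S n, ℝ)).tendsto _).comp (tendsto_mean hu hK hKk hlim)
  exact tendsto_integral_bodyMeasure stableDensity_detH hK hKk hlim
    (((h1.const_sub ⟨u, hu.continuous⟩).pow 2).mul ((continuous_suppC.tendsto K).comp hlim))
    (fun _ _ => rfl) fun _ => rfl

lemma tendsto_integral_sq_mul_inv {z : S n → ℝ} (hz : SphereC2 z) (hK : IsEvenBody K)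
    (hKk : ∀ k, IsEvenC2Plus (Kk k)) (hlim : Tendsto Kk atTop (𝓝 K)) :
    Tendsto (fun k => ∫ x, z x ^ 2 * (supp (Kk k) x)⁻¹ ∂(surfMeasure (Kk k))) atTop
      (𝓝 (∫ x, z x ^ 2 * (supp K x)⁻¹ ∂(surfMeasure K))) := by
  have h1 : Tendsto (fun k => Ring.inverse (suppC (Kk k))) atTop (𝓝 (Ring.inverse (suppC K))) :=
    (NormedRing.inverse_continuousAt hK.isUnit_suppC.unit).tendsto.comp
      ((continuous_suppC.tendsto K).comp hlim)
  refine tendsto_integral_bodyMeasure stableDensity_detH hK hKk hlim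
    (h1.const_mul ((⟨z, hz.continuous⟩ : C(S n, ℝ)) ^ 2)) (fun k x => ?_) fun x => ?_
  · rw [ContinuousMap.mul_apply, IsEvenBody.inverse_suppC_apply (hKk k).1]
    rfl
  · rw [ContinuousMap.mul_apply, hK.inverse_suppC_apply]
    rfl

lemma tendsto_energy' {z : S n → ℝ} (hz : SphereC2 z) (hK : IsEvenBody K)
    (hKk : ∀ k, IsEvenC2Plus (Kk k)) (hlim : Tendsto Kk atTop (𝓝 K)) :
    Tendsto (fun k => energy' (Kk k) z) atTop (𝓝 (energy' K z)) := by
  have h1 : Tendsto (fun k => ∫ _x, (1 : ℝ) ∂(gradMeasure (Kk k) z)) atTop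
      (𝓝 (∫ _x, (1 : ℝ) ∂(gradMeasure K z))) :=
    tendsto_integral_bodyMeasure (stableDensity_gradDensity hz) hK hKk hlim
      (tendsto_const_nhds (x := (1 : C(S n, ℝ)))) (fun _ _ => rfl) fun _ => rfl
  have h2 : Tendsto (fun k => ∫ x, z x ^ 2 ∂(traceMeasure (Kk k))) atTop
      (𝓝 (∫ x, z x ^ 2 ∂(traceMeasure K))) :=
    tendsto_integral_bodyMeasure stableDensity_traceDensity hK hKk hlim
      (tendsto_const_nhds (x := (⟨z, hz.continuous⟩ : C(S n, ℝ)) ^ 2)) (fun _ _ => rfl)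
      fun _ => rfl
  exact (h1.sub h2).add ((tendsto_integral_sq_mul_inv hz hK hKk hlim).const_mul (n : ℝ))

lemma tendsto_spread' {z : S n → ℝ} (hz : SphereC2 z) (hK : IsEvenBody K)
    (hKk : ∀ k, IsEvenC2Plus (Kk k)) (hlim : Tendsto Kk atTop (𝓝 K)) :
    Tendsto (fun k => spread' (Kk k) z) atTop (𝓝 (spread' K z)) :=
  (tendsto_integral_sq_mul_inv hz hK hKk hlim).sub
    (((tendsto_integral_supp hK hKk hlim).inv₀
      (integral_supp_surfMeasure_pos hK hKk hlim).ne').mul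
    ((tendsto_integral_bodyMeasure stableDensity_detH hK hKk hlim
      (tendsto_const_nhds (x := (⟨z, hz.continuous⟩ : C(S n, ℝ)))) (fun _ _ => rfl)
      fun _ => rfl).pow 2))

end Limits

/-- Fix a competitor `u` of the limit problem. Its denominators are eventually nonzero, so the
infima are eventually at most its quotients, which converge. -/
lemma limsup_iInf_quotient_le {α : Type*} {P : α → Prop} {a b : ℕ → α → ℝ} {a' b' : α → ℝ}
    (ha : ∀ u, P u → Tendsto (fun k => a k u) atTop (𝓝 (a' u)))
    (hb : ∀ u, P u → Tendsto (fun k => b k u) atTop (𝓝 (b' u))) :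
    limsup (fun k => ⨅ (u : α) (_ : P u) (_ : b k u ≠ 0), ((a k u / b k u : ℝ) : EReal)) atTop
      ≤ ⨅ (u : α) (_ : P u) (_ : b' u ≠ 0), ((a' u / b' u : ℝ) : EReal) := by
  refine le_iInf fun u => le_iInf fun hu => le_iInf fun h0 => ?_
  have h1 : Tendsto (fun k => ((a k u / b k u : ℝ) : EReal)) atTop (𝓝 ((a' u / b' u : ℝ) : EReal)) :=
    (continuous_coe_real_ereal.tendsto _).comp ((ha u hu).div (hb u hu) h0)
  rw [← h1.limsup_eq]
  refine limsup_le_limsup ?_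
  filter_upwards [(hb u hu).eventually_ne h0] with k hk
  exact iInf_le_of_le u (iInf_le_of_le hu (iInf_le _ hk))

end EvenEigenvalue

end

theorem mainTheorem6 (n : ℕ) (hn : 1 ≤ n)
    (K : ConvexBody (EuclideanSpace ℝ (Fin (n + 1))))
    (Kk : ℕ → ConvexBody (EuclideanSpace ℝ (Fin (n + 1))))
    (hK : EvenEigenvalue.IsEvenBody K)
    (hKk : ∀ k, EvenEigenvalue.IsEvenC2Plus (Kk k))
    (hlim : Tendsto Kk atTop (𝓝 K)) :
    (∀ u : EvenEigenvalue.S n → ℝ, EvenEigenvalue.IsEvenC2 u →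
      EvenEigenvalue.WeakConv (fun k => EvenEigenvalue.gradMeasure (Kk k) u) atTop
        (EvenEigenvalue.gradMeasure K u)) ∧
    EvenEigenvalue.WeakConv (fun k => EvenEigenvalue.traceMeasure (Kk k)) atTop
      (EvenEigenvalue.traceMeasure K) ∧
    EvenEigenvalue.WeakConv (fun k => EvenEigenvalue.surfMeasure (Kk k)) atTop
      (EvenEigenvalue.surfMeasure K) ∧
    limsup (fun k => EvenEigenvalue.eigenL (Kk k)) atTop ≤ EvenEigenvalue.eigenL K ∧
    limsup (fun k => EvenEigenvalue.eigenK (Kk k)) atTop ≤ EvenEigenvalue.eigenK K :=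
  ⟨fun _ hu => ((EvenEigenvalue.stableDensity_gradDensity hu.sphereC2).weakConv hK hKk hlim).2,
    (EvenEigenvalue.stableDensity_traceDensity.weakConv hK hKk hlim).2,
    (EvenEigenvalue.stableDensity_detH.weakConv hK hKk hlim).2,
    EvenEigenvalue.limsup_iInf_quotient_le
      (fun _ hu => EvenEigenvalue.tendsto_energy hu.sphereC2 hK hKk hlim)
      (fun _ hu => EvenEigenvalue.tendsto_spread hu.sphereC2 hK hKk hlim),
    EvenEigenvalue.limsup_iInf_quotient_le
      (fun _ hu => EvenEigenvalue.tendsto_energy' hu.sphereC2 hK hKk hlim)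
      (fun _ hu => EvenEigenvalue.tendsto_spread' hu.sphereC2 hK hKk hlim)⟩
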